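/- Let $0<b\le+\infty$, let $0=x_0<x_1<x_2<\dots<b$ with $\lim_{n\to\infty}x_n=b$, put $d_n:=x_n-x_{n-1}$ for $n\ge 1$, and assume $\sup_{n\ge1}d_n<\infty$ (the case $\inf_n d_n=0$ is allowed). For an interval $J$ let $W^{2,2}(J)$ be the set of $f\in L^2(J)$ (complex-valued) such that $f,f'$ are locally absolutely continuous on $J$ and $f''\in L^2(J)$. Let $H_{\min}=-\frac{d^2}{dx^2}$ in $L^2[0,b)$ with domain $\{f\in W^{2,2}[0,b): f(x_n)=f'(x_n)=0 \text{ for all } n\ge0\}$, and for $n\ge1$ let $H_n=-\frac{d^2}{dx^2}$ in $L^2[x_{n-1},x_n]$ with domain $W^{2,2}_0[x_{n-1},x_n]=\{f\in W^{2,2}[x_{n-1},x_n]: f=f'=0 \text{ at } x_{n-1} \text{ and } x_n\}$. A boundary triplet for the adjoint $A^*$ of a densely defined closed symmetric operator $A$ in a Hilbert space $\mathfrak H$ is a triplet $\{\mathcal H,\Gamma_0,\Gamma_1\}$, where $\mathcal H$ is a Hilbert space and $\Gamma_0,\Gamma_1:\operatorname{dom}(A^*)\to\mathcal H$ are linear maps,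 bounded with respect to the graph norm of $A^*$, such that $$(A^*f,g)_{\mathfrak H}-(f,A^*g)_{\mathfrak H}=(\Gamma_1f,\Gamma_0g)_{\mathcal H}-(\Gamma_0f,\Gamma_1g)_{\mathcal H}\qquad\text{for all } f,g\in\operatorname{dom}(A^*),$$ and $f\mapsto(\Gamma_0f,\Gamma_1f)$ maps $\operatorname{dom}(A^*)$ onto $\mathcal H\oplus\mathcal H$. Identify $L^2[0,b)$ with $\bigoplus_{n\ge1}L^2[x_{n-1},x_n]$ by $f\mapsto(f_n)_n$, where $f_n$ is the restriction of $f$ to $[x_{n-1},x_n]$. For maps $\Gamma_j^{(n)}:W^{2,2}[x_{n-1},x_n]\to\mathbb C^2$ ($j=0,1$), the direct sum of the triplets $\Pi_n=\{\mathbb C^2,\Gamma_0^{(n)},\Gamma_1^{(n)}\}$ is $\Pi=\{\ell^2(\mathbb N,\mathbb C^2),\Gamma_0,\Gamma_1\}$ with $\Gamma_jf=(\Gamma_j^{(n)}f_n)_n$ and $\operatorname{dom}(\Gamma_j)=\{f\in\operatorname{dom}(H_{\min}^*):\sum_n\|\Gamma_j^{(n)}f_n\|^2<\infty\}$. Then $H_{\min}=\bigoplus_nH_n$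 and $H_{\min}^*=\bigoplus_nH_n^*$. Moreover, for each of the two families $$\text{(A)}\quad \Gamma_0^{(n)}f=\begin{pmatrix}d_n^{1/2}f(x_{n-1}+)\\-d_n^{1/2}f(x_n-)\end{pmatrix},\qquad \Gamma_1^{(n)}f=\begin{pmatrix}d_n^{-3/2}\bigl(d_nf'(x_{n-1}+)+f(x_{n-1}+)-f(x_n-)\bigr)\\ d_n^{-3/2}\bigl(d_nf'(x_n-)+f(x_{n-1}+)-f(x_n-)\bigr)\end{pmatrix},$$ $$\text{(B)}\quad \Gamma_0^{(n)}f=\begin{pmatrix}d_n^{1/2}f(x_{n-1}+)\\d_n^{3/2}f'(x_n-)\end{pmatrix},\qquad \Gamma_1^{(n)}f=\begin{pmatrix}d_n^{-1/2}\bigl(f'(x_{n-1}+)-f'(x_n-)\bigr)\\ d_n^{-3/2}\bigl(f(x_n-)-f(x_{n-1}+)-d_nf'(x_n-)\bigr)\end{pmatrix},$$ where $f\in W^{2,2}[x_{n-1},x_n]$: (i) for every $n\ge1$ the triplet $\Pi_n=\{\mathbb C^2,\Gamma_0^{(n)},\Gamma_1^{(n)}\}$ is a boundary triplet for $H_n^*$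 (in particular $H_n$ is densely defined, closed and symmetric, and $\operatorname{dom}(H_n^*)=W^{2,2}[x_{n-1},x_n]$); (ii) the direct sum $\Pi=\bigoplus_{n\ge1}\Pi_n$ is a boundary triplet for $H_{\min}^*$ (in particular $H_{\min}$ is densely defined, closed and symmetric, and $\operatorname{dom}(\Gamma_0)=\operatorname{dom}(\Gamma_1)=\operatorname{dom}(H_{\min}^*)$). -/

import Mathlib

open MeasureTheory Set Filter Topology

noncomputable section

namespace BoundaryTriplets

/-! ### Abstract boundary triplets -/

section Abstract

variable {E : Type*} [NormedAddCommGroup E] [InnerProductSpace ℂ E] [CompleteSpace E]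
variable {H : Type*} [NormedAddCommGroup H] [InnerProductSpace ℂ H]

/-- `{H, Γ₀, Γ₁}` is a boundary triplet for the adjoint `A†` of the densely defined closed symmetric
operator `A` in `E`. The maps `Γ₀`, `Γ₁` are a priori only partially defined; it is part of the
definition that both are defined exactly on `dom A†`. Boundedness refers to the graph norm of `A†`.
The inner product of Mathlib is linear in its second argument, so `(f, g)` is `inner ℂ g f`. -/
structure IsBoundaryTriplet (A : E →ₗ.[ℂ] E) (Γ₀ Γ₁ : E →ₗ.[ℂ] H) : Prop where
  dense_domain : Dense (A.domain : Set E)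
  isClosed : A.IsClosed
  symmetric : A ≤ A.adjoint
  complete : CompleteSpace H
  dom₀ : Γ₀.domain = A.adjoint.domain
  dom₁ : Γ₁.domain = A.adjoint.domain
  bounded₀ : ∃ C : ℝ, ∀ f : A.adjoint.domain,
    ‖Γ₀ ⟨f, dom₀.ge f.2⟩‖ ^ 2 ≤ C * (‖(f : E)‖ ^ 2 + ‖A.adjoint f‖ ^ 2)
  bounded₁ : ∃ C : ℝ, ∀ f : A.adjoint.domain,
    ‖Γ₁ ⟨f, dom₁.ge f.2⟩‖ ^ 2 ≤ C * (‖(f : E)‖ ^ 2 + ‖A.adjoint f‖ ^ 2)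
  green : ∀ f g : A.adjoint.domain,
    inner ℂ (g : E) (A.adjoint f) - inner ℂ (A.adjoint g) (f : E) =
      inner ℂ (Γ₀ ⟨g, dom₀.ge g.2⟩) (Γ₁ ⟨f, dom₁.ge f.2⟩) -
        inner ℂ (Γ₁ ⟨g, dom₁.ge g.2⟩) (Γ₀ ⟨f, dom₀.ge f.2⟩)
  surjective : ∀ h₀ h₁ : H, ∃ f : A.adjoint.domain,
    Γ₀ ⟨f, dom₀.ge f.2⟩ = h₀ ∧ Γ₁ ⟨f, dom₁.ge f.2⟩ = h₁

end Abstract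

/-! ### Direct sums -/

section DirectSum

variable {G G' : ℕ → Type*}
variable [∀ n, NormedAddCommGroup (G n)] [∀ n, InnerProductSpace ℂ (G n)]
variable [∀ n, NormedAddCommGroup (G' n)] [∀ n, InnerProductSpace ℂ (G' n)]

/-- The direct sum `⊕ₙ Sₙ` between Hilbert direct sums: its domain consists of the `f = (fₙ)` with
`fₙ ∈ dom Sₙ` for all `n` and `∑ ‖Sₙ fₙ‖² < ∞`, and it sends `f` to `(Sₙ fₙ)`. -/
def directSum (S : ∀ n, G n →ₗ.[ℂ] G' n) : lp G 2 →ₗ.[ℂ] lp G' 2 where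
  domain :=
    { carrier := {f | ∃ h : ∀ n, f n ∈ (S n).domain, Memℓp (fun n => S n ⟨f n, h n⟩) 2}
      zero_mem' := by
        refine ⟨fun n => (S n).domain.zero_mem, ?_⟩
        have : (fun n => S n ⟨(0 : lp G 2) n, (S n).domain.zero_mem⟩) = 0 := by
          funext n; exact (S n).map_zero
        rw [this]; exact zero_memℓp
      add_mem' := by
        rintro f g ⟨hf, hf'⟩ ⟨hg, hg'⟩
        refine ⟨fun n => (S n).domain.add_mem (hf n) (hg n), ?_⟩
        have := hf'.add hg'
        convert! this using 1
        funext n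
        exact (S n).map_add ⟨f n, hf n⟩ ⟨g n, hg n⟩
      smul_mem' := by
        rintro c f ⟨hf, hf'⟩
        refine ⟨fun n => (S n).domain.smul_mem c (hf n), ?_⟩
        have := hf'.const_smul c
        convert! this using 1
        funext n
        exact (S n).map_smul c ⟨f n, hf n⟩ }
  toFun :=
    { toFun := fun f => ⟨fun n => S n ⟨(f : lp G 2) n, f.2.choose n⟩, f.2.choose_spec⟩
      map_add' := by
        intro f g
        ext n : 2
        exact (S n).map_add ⟨(f : lp G 2) n, f.2.choose n⟩ ⟨(g : lp G 2) n, g.2.choose n⟩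
      map_smul' := by
        intro c f
        ext n : 2
        exact (S n).map_smul c ⟨(f : lp G 2) n, f.2.choose n⟩ }

/-- The composition `T ∘ U`, with domain `{f | U f ∈ dom T}`. -/
def pullback {E F K : Type*} [NormedAddCommGroup E] [InnerProductSpace ℂ E]
    [NormedAddCommGroup F] [InnerProductSpace ℂ F] [NormedAddCommGroup K] [InnerProductSpace ℂ K]
    (T : F →ₗ.[ℂ] K) (U : E →ₗ[ℂ] F) : E →ₗ.[ℂ] K where
  domain := T.domain.comap U
  toFun := T.toFun ∘ₗ (U.restrict fun _ hf => hf)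

end DirectSum

/-! ### The Sobolev space `W^{2,2}` on an interval -/

/-- The complex Hilbert space `L²(J)`. -/
abbrev L2 (J : Set ℝ) : Type := Lp ℂ 2 (volume.restrict J)

/-- An interval of positive length. -/
structure IsInterval (J : Set ℝ) : Prop where
  convex : Convex ℝ J
  interior_nonempty : (interior J).Nonempty

/-- `u` is locally absolutely continuous on the interval `J`. -/
def IsACLoc (J : Set ℝ) (u : ℝ → ℂ) : Prop :=
  ∀ s ∈ J, ∀ t ∈ J, AbsolutelyContinuousOnInterval u s t

/-- `f ∈ W^{2,2}(J)` with continuously differentiable representative `u`, and `v = f'`, `w = f''`: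
both `u` and its derivative `v` are locally absolutely continuous on `J`, and the almost everywhere
existing derivative `w` of `v` belongs to `L²(J)`. -/
structure IsRep (J : Set ℝ) (f : L2 J) (u v : ℝ → ℂ) (w : L2 J) : Prop where
  ae_eq : f =ᵐ[volume.restrict J] u
  ac : IsACLoc J u
  hasDeriv : ∀ t ∈ J, HasDerivWithinAt u (v t) J t
  ac_deriv : IsACLoc J v
  hasDeriv_deriv : ∀ᵐ t ∂volume.restrict J, HasDerivWithinAt v (w t) J t

theorem IsRep.zero (J : Set ℝ) : IsRep J 0 0 0 0 where
  ae_eq := Lp.coeFn_zero _ _ _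
  ac := fun s _ t _ => (LipschitzWith.const (0 : ℂ)).lipschitzOnWith.absolutelyContinuousOnInterval
  hasDeriv := fun t _ => hasDerivWithinAt_const _ _ _
  ac_deriv := fun s _ t _ =>
    (LipschitzWith.const (0 : ℂ)).lipschitzOnWith.absolutelyContinuousOnInterval
  hasDeriv_deriv := by
    filter_upwards [Lp.coeFn_zero ℂ 2 (volume.restrict J)] with t ht
    rw [ht]
    exact hasDerivWithinAt_const _ _ _

theorem IsRep.add {J : Set ℝ} {f f' : L2 J} {u v u' v' : ℝ → ℂ} {w w' : L2 J}
    (h : IsRep J f u v w) (h' : IsRep J f' u' v' w') :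
    IsRep J (f + f') (u + u') (v + v') (w + w') where
  ae_eq := (Lp.coeFn_add f f').trans (h.ae_eq.add h'.ae_eq)
  ac := fun s hs t ht => (h.ac s hs t ht).add (h'.ac s hs t ht)
  hasDeriv := fun t ht => (h.hasDeriv t ht).add (h'.hasDeriv t ht)
  ac_deriv := fun s hs t ht => (h.ac_deriv s hs t ht).add (h'.ac_deriv s hs t ht)
  hasDeriv_deriv := by
    filter_upwards [Lp.coeFn_add w w', h.hasDeriv_deriv, h'.hasDeriv_deriv] with t ht h1 h2
    rw [ht]
    exact h1.add h2

theorem IsRep.smul {J : Set ℝ} {f : L2 J} {u v : ℝ → ℂ} {w : L2 J} (c : ℂ)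
    (h : IsRep J f u v w) : IsRep J (c • f) (c • u) (c • v) (c • w) where
  ae_eq := (Lp.coeFn_smul c f).trans (h.ae_eq.const_smul c)
  ac := fun s hs t ht => (h.ac s hs t ht).const_smul c
  hasDeriv := fun t ht => (h.hasDeriv t ht).const_smul c
  ac_deriv := fun s hs t ht => (h.ac_deriv s hs t ht).const_smul c
  hasDeriv_deriv := by
    filter_upwards [Lp.coeFn_smul c w, h.hasDeriv_deriv] with t ht h1
    rw [ht]
    exact h1.const_smul c

theorem IsRep.unique {J : Set ℝ} (hJ : IsInterval J) {f : L2 J} {u v u' v' : ℝ → ℂ} {w w' : L2 J}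
    (h : IsRep J f u v w) (h' : IsRep J f u' v' w') :
    EqOn u u' J ∧ EqOn v v' J ∧ w = w' := by
  have hud : UniqueDiffOn ℝ J := uniqueDiffOn_convex hJ.convex hJ.interior_nonempty
  have hcl : J ⊆ closure (interior J) := by
    rw [hJ.convex.closure_interior_eq_closure_of_nonempty_interior hJ.interior_nonempty]
    exact subset_closure
  have hu : EqOn u u' J :=
    Measure.eqOn_of_ae_eq (h.ae_eq.symm.trans h'.ae_eq)
      (fun t ht => (h.hasDeriv t ht).continuousWithinAt)
      (fun t ht => (h'.hasDeriv t ht).continuousWithinAt) hcl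
  have hv : EqOn v v' J := fun t ht =>
    (hud t ht).eq_deriv _ (h.hasDeriv t ht) ((h'.hasDeriv t ht).congr hu (hu ht))
  have hJm : NullMeasurableSet J volume := hJ.convex.nullMeasurableSet volume
  refine ⟨hu, hv, Lp.ext ?_⟩
  filter_upwards [h.hasDeriv_deriv, h'.hasDeriv_deriv, ae_restrict_mem₀ hJm] with t h1 h2 ht
  exact (hud t ht).eq_deriv _ h1 (h2.congr hv (hv ht))

/-- The Sobolev space `W^{2,2}(J)`. -/
def W22 (J : Set ℝ) : Submodule ℂ (L2 J) where
  carrier := {f | ∃ u v w, IsRep J f u v w}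
  zero_mem' := ⟨_, _, _, IsRep.zero J⟩
  add_mem' := by
    rintro f g ⟨u, v, w, h⟩ ⟨u', v', w', h'⟩
    exact ⟨_, _, _, h.add h'⟩
  smul_mem' := by
    rintro c f ⟨u, v, w, h⟩
    exact ⟨_, _, _, h.smul c⟩

/-- The subspace of those `f ∈ W^{2,2}(J)` with `f(t) = f'(t) = 0` for all `t ∈ X`. -/
def W22Zero (J X : Set ℝ) : Submodule ℂ (L2 J) where
  carrier := {f | ∃ u v w, IsRep J f u v w ∧ ∀ t ∈ X, u t = 0 ∧ v t = 0}
  zero_mem' := ⟨_, _, _, IsRep.zero J, fun _ _ => ⟨rfl, rfl⟩⟩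
  add_mem' := by
    rintro f g ⟨u, v, w, h, h0⟩ ⟨u', v', w', h', h0'⟩
    exact ⟨_, _, _, h.add h', fun t ht => by simp [h0 t ht, h0' t ht]⟩
  smul_mem' := by
    rintro c f ⟨u, v, w, h, h0⟩
    exact ⟨_, _, _, h.smul c, fun t ht => by simp [h0 t ht]⟩

/-- The continuously differentiable representative of `f ∈ W^{2,2}(J)`. On `J` it is unique, and its
values at the end points of `J` that belong to `J` are the one-sided limits of `f` there. -/
def rep {J : Set ℝ} (f : W22 J) : ℝ → ℂ := f.2.choose

/-- The first derivative of `f ∈ W^{2,2}(J)`, as a function that is continuous on `J`. -/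
def repDeriv {J : Set ℝ} (f : W22 J) : ℝ → ℂ := f.2.choose_spec.choose

/-- The second derivative of `f ∈ W^{2,2}(J)`. -/
def secondDeriv {J : Set ℝ} (f : W22 J) : L2 J := f.2.choose_spec.choose_spec.choose

theorem isRep {J : Set ℝ} (f : W22 J) : IsRep J f (rep f) (repDeriv f) (secondDeriv f) :=
  f.2.choose_spec.choose_spec.choose_spec

theorem rep_add {J : Set ℝ} (hJ : IsInterval J) (f g : W22 J) {t : ℝ} (ht : t ∈ J) :
    rep (f + g) t = rep f t + rep g t :=
  ((isRep (f + g)).unique hJ ((isRep f).add (isRep g))).1 ht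

theorem rep_smul {J : Set ℝ} (hJ : IsInterval J) (c : ℂ) (f : W22 J) {t : ℝ} (ht : t ∈ J) :
    rep (c • f) t = c * rep f t :=
  ((isRep (c • f)).unique hJ ((isRep f).smul c)).1 ht

theorem repDeriv_add {J : Set ℝ} (hJ : IsInterval J) (f g : W22 J) {t : ℝ} (ht : t ∈ J) :
    repDeriv (f + g) t = repDeriv f t + repDeriv g t :=
  ((isRep (f + g)).unique hJ ((isRep f).add (isRep g))).2.1 ht

theorem repDeriv_smul {J : Set ℝ} (hJ : IsInterval J) (c : ℂ) (f : W22 J) {t : ℝ} (ht : t ∈ J) :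
    repDeriv (c • f) t = c * repDeriv f t :=
  ((isRep (c • f)).unique hJ ((isRep f).smul c)).2.1 ht

/-- The operator `-d²/dx²` in `L²(J)` with domain `W^{2,2}(J)`. -/
def negSecondDeriv {J : Set ℝ} (hJ : IsInterval J) : L2 J →ₗ.[ℂ] L2 J where
  domain := W22 J
  toFun :=
    { toFun := fun f => -secondDeriv f
      map_add' := fun f g => by
        have := ((isRep (f + g)).unique hJ ((isRep f).add (isRep g))).2.2
        rw [this, neg_add]
      map_smul' := fun c f => by
        have := ((isRep (c • f)).unique hJ ((isRep f).smul c)).2.2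
        rw [this, RingHom.id_apply, smul_neg] }

/-- The operator `-d²/dx²` in `L²(J)` with domain
`{f ∈ W^{2,2}(J) | f(t) = f'(t) = 0 for all t ∈ X}`. -/
def minimalOperator {J : Set ℝ} (hJ : IsInterval J) (X : Set ℝ) : L2 J →ₗ.[ℂ] L2 J :=
  (negSecondDeriv hJ).domRestrict (W22Zero J X)

theorem isInterval_Icc {a b : ℝ} (hab : a < b) : IsInterval (Icc a b) where
  convex := convex_Icc a b
  interior_nonempty := by rw [interior_Icc]; exact nonempty_Ioo.2 hab

/-- The minimal operator `-d²/dx²` in `L²[a, b]`, with domain `W^{2,2}_0[a, b]`. -/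
def intervalOperator {a b : ℝ} (hab : a < b) : L2 (Icc a b) →ₗ.[ℂ] L2 (Icc a b) :=
  minimalOperator (isInterval_Icc hab) {a, b}

/-! ### The regularized boundary maps on `[a, b]`, with `d = b - a` -/

/-- First triplet: `Γ₀ f = (d^{1/2} f(a+), -d^{1/2} f(b-))`. -/
def gammaZeroA {a b : ℝ} (hab : a < b) : L2 (Icc a b) →ₗ.[ℂ] EuclideanSpace ℂ (Fin 2) where
  domain := W22 (Icc a b)
  toFun :=
    { toFun := fun f =>
        !₂[(((b - a) ^ (1 / 2 : ℝ) : ℝ) : ℂ) * rep f a,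
          -(((b - a) ^ (1 / 2 : ℝ) : ℝ) : ℂ) * rep f b]
      map_add' := fun f g => by
        have hJ := isInterval_Icc hab
        have ha := left_mem_Icc.2 hab.le
        have hb := right_mem_Icc.2 hab.le
        ext i
        fin_cases i <;> simp [rep_add hJ, ha, hb] <;> ring
      map_smul' := fun c f => by
        have hJ := isInterval_Icc hab
        have ha := left_mem_Icc.2 hab.le
        have hb := right_mem_Icc.2 hab.le
        ext i
        fin_cases i <;> simp [rep_smul hJ, ha, hb] <;> ring }

/-- First triplet: `Γ₁ f` has the components `(d f'(a+) + (f(a+) - f(b-))) / d^{3/2}` and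
`(d f'(b-) + (f(a+) - f(b-))) / d^{3/2}`. -/
def gammaOneA {a b : ℝ} (hab : a < b) : L2 (Icc a b) →ₗ.[ℂ] EuclideanSpace ℂ (Fin 2) where
  domain := W22 (Icc a b)
  toFun :=
    { toFun := fun f =>
        !₂[(((b - a : ℝ) : ℂ) * repDeriv f a + (rep f a - rep f b)) / (((b - a) ^ (3 / 2 : ℝ) : ℝ) : ℂ),
          (((b - a : ℝ) : ℂ) * repDeriv f b + (rep f a - rep f b)) / (((b - a) ^ (3 / 2 : ℝ) : ℝ) : ℂ)]
      map_add' := fun f g => by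
        have hJ := isInterval_Icc hab
        have ha := left_mem_Icc.2 hab.le
        have hb := right_mem_Icc.2 hab.le
        ext i
        fin_cases i <;> simp [rep_add hJ, repDeriv_add hJ, ha, hb] <;> ring
      map_smul' := fun c f => by
        have hJ := isInterval_Icc hab
        have ha := left_mem_Icc.2 hab.le
        have hb := right_mem_Icc.2 hab.le
        ext i
        fin_cases i <;> simp [rep_smul hJ, repDeriv_smul hJ, ha, hb] <;> ring }

/-- Second triplet: `Γ₀ f = (d^{1/2} f(a+), d^{3/2} f'(b-))`. -/
def gammaZeroB {a b : ℝ} (hab : a < b) : L2 (Icc a b) →ₗ.[ℂ] EuclideanSpace ℂ (Fin 2) where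
  domain := W22 (Icc a b)
  toFun :=
    { toFun := fun f =>
        !₂[(((b - a) ^ (1 / 2 : ℝ) : ℝ) : ℂ) * rep f a,
          (((b - a) ^ (3 / 2 : ℝ) : ℝ) : ℂ) * repDeriv f b]
      map_add' := fun f g => by
        have hJ := isInterval_Icc hab
        have ha := left_mem_Icc.2 hab.le
        have hb := right_mem_Icc.2 hab.le
        ext i
        fin_cases i <;> simp [rep_add hJ, repDeriv_add hJ, ha, hb] <;> ring
      map_smul' := fun c f => by
        have hJ := isInterval_Icc hab
        have ha := left_mem_Icc.2 hab.le
        have hb := right_mem_Icc.2 hab.le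
        ext i
        fin_cases i <;> simp [rep_smul hJ, repDeriv_smul hJ, ha, hb] <;> ring }

/-- Second triplet: `Γ₁ f` has the components `(f'(a+) - f'(b-)) / d^{1/2}` and
`(f(b-) - f(a+) - d f'(b-)) / d^{3/2}`. -/
def gammaOneB {a b : ℝ} (hab : a < b) : L2 (Icc a b) →ₗ.[ℂ] EuclideanSpace ℂ (Fin 2) where
  domain := W22 (Icc a b)
  toFun :=
    { toFun := fun f =>
        !₂[(repDeriv f a - repDeriv f b) / (((b - a) ^ (1 / 2 : ℝ) : ℝ) : ℂ),
          (rep f b - rep f a - ((b - a : ℝ) : ℂ) * repDeriv f b) / (((b - a) ^ (3 / 2 : ℝ) : ℝ) : ℂ)]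
      map_add' := fun f g => by
        have hJ := isInterval_Icc hab
        have ha := left_mem_Icc.2 hab.le
        have hb := right_mem_Icc.2 hab.le
        ext i
        fin_cases i <;> simp [rep_add hJ, repDeriv_add hJ, ha, hb] <;> ring
      map_smul' := fun c f => by
        have hJ := isInterval_Icc hab
        have ha := left_mem_Icc.2 hab.le
        have hb := right_mem_Icc.2 hab.le
        ext i
        fin_cases i <;> simp [rep_smul hJ, repDeriv_smul hJ, ha, hb] <;> ring }

/-! ### The half-open interval `[0, b)` and its partition -/

/-- The interval `[0, b)`, where `b = +∞` is allowed. -/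
def halfOpen (b : EReal) : Set ℝ := {t | 0 ≤ t ∧ (t : EReal) < b}

/-- `0 = x₀ < x₁ < x₂ < ⋯ < b` and `xₙ → b ≤ +∞`. -/
structure IsPartition (b : EReal) (x : ℕ → ℝ) : Prop where
  zero : x 0 = 0
  strictMono : StrictMono x
  tendsto : Tendsto (fun n => (x n : EReal)) atTop (𝓝 b)

namespace IsPartition

variable {b : EReal} {x : ℕ → ℝ}

/-- The `n`-th cell `[xₙ, xₙ₊₁]`. -/
abbrev cell (x : ℕ → ℝ) (n : ℕ) : Set ℝ := Icc (x n) (x (n + 1))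

theorem lt (hx : IsPartition b x) (n : ℕ) : (x n : EReal) < b := by
  have h1 : Monotone fun n => (x n : EReal) :=
    fun i j hij => EReal.coe_le_coe_iff.2 (hx.strictMono.monotone hij)
  exact lt_of_lt_of_le (EReal.coe_lt_coe_iff.2 (hx.strictMono (Nat.lt_succ_self n)))
    (h1.ge_of_tendsto hx.tendsto (n + 1))

theorem step (hx : IsPartition b x) (n : ℕ) : x n < x (n + 1) := hx.strictMono (Nat.lt_succ_self n)

theorem iUnion_cell (hx : IsPartition b x) : ⋃ n, cell x n = halfOpen b := by
  ext t
  simp only [mem_iUnion, mem_Icc, halfOpen]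
  constructor
  · rintro ⟨n, h1, h2⟩
    refine ⟨?_, lt_of_le_of_lt (EReal.coe_le_coe_iff.2 h2) (hx.lt (n + 1))⟩
    rw [← hx.zero]
    exact (hx.strictMono.monotone (Nat.zero_le n)).trans h1
  · rintro ⟨h0, hb⟩
    have hex : ∃ n, t < x n := by
      obtain ⟨n, hn⟩ := (hx.tendsto.eventually (lt_mem_nhds hb)).exists
      exact ⟨n, EReal.coe_lt_coe_iff.1 hn⟩
    classical
    obtain ⟨n, hn⟩ : ∃ n, Nat.find hex = n + 1 := by
      refine Nat.exists_eq_succ_of_ne_zero fun h => ?_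
      have := Nat.find_spec hex
      rw [h, hx.zero] at this
      exact absurd h0 (not_le.2 this)
    refine ⟨n, ?_, ?_⟩
    · exact not_lt.1 (Nat.find_min hex (by omega))
    · rw [← hn]; exact (Nat.find_spec hex).le

theorem cell_subset (hx : IsPartition b x) (n : ℕ) : cell x n ⊆ halfOpen b := by
  rw [← hx.iUnion_cell]; exact subset_iUnion (cell x) n

theorem aedisjoint (hx : IsPartition b x) : Pairwise (Function.onFun (AEDisjoint volume) (cell x)) := by
  have key : ∀ i j, i < j → AEDisjoint volume (cell x i) (cell x j) := by
    intro i j hij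
    refine measure_mono_null (t := {x (i + 1)}) ?_ (by simp)
    rintro t ⟨h1, h2⟩
    have : x (i + 1) ≤ x j := hx.strictMono.monotone hij
    exact le_antisymm h1.2 (this.trans h2.1)
  intro i j hij
  rcases lt_or_gt_of_ne hij with h | h
  · exact key i j h
  · exact (key j i h).symm

theorem restrict_eq_sum (hx : IsPartition b x) :
    (volume : Measure ℝ).restrict (halfOpen b) =
      Measure.sum fun n => volume.restrict (cell x n) := by
  rw [← hx.iUnion_cell]
  exact Measure.restrict_iUnion_ae hx.aedisjoint fun _ => measurableSet_Icc.nullMeasurableSet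

theorem isInterval (hx : IsPartition b x) : IsInterval (halfOpen b) where
  convex := by
    refine OrdConnected.convex ⟨?_⟩
    rintro s ⟨h1, _⟩ t ⟨_, h2⟩ r ⟨h3, h4⟩
    exact ⟨h1.trans h3, lt_of_le_of_lt (EReal.coe_le_coe_iff.2 h4) h2⟩
  interior_nonempty :=
    (isInterval_Icc (hx.step 0)).interior_nonempty.mono (interior_mono (hx.cell_subset 0))

/-- Restriction of functions from `[0, b)` to the `n`-th cell. -/
def restrictCell (hx : IsPartition b x) (n : ℕ) : L2 (halfOpen b) →ₗ[ℂ] L2 (cell x n) where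
  toFun f := ((Lp.memLp f).mono_measure (Measure.restrict_mono (hx.cell_subset n) le_rfl)).toLp f
  map_add' f g := by
    rw [← MemLp.toLp_add, MemLp.toLp_eq_toLp_iff]
    exact ae_restrict_of_ae_restrict_of_subset (hx.cell_subset n) (Lp.coeFn_add f g)
  map_smul' c f := by
    rw [RingHom.id_apply, ← MemLp.toLp_const_smul, MemLp.toLp_eq_toLp_iff]
    exact ae_restrict_of_ae_restrict_of_subset (hx.cell_subset n) (Lp.coeFn_smul c f)

theorem restrictCell_ae (hx : IsPartition b x) (n : ℕ) (f : L2 (halfOpen b)) :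
    hx.restrictCell n f =ᵐ[volume.restrict (cell x n)] f :=
  MemLp.coeFn_toLp
    ((Lp.memLp f).mono_measure (Measure.restrict_mono (hx.cell_subset n) le_rfl))

theorem lintegral_eq_tsum (hx : IsPartition b x) (g : ℝ → ENNReal) :
    ∫⁻ t in halfOpen b, g t = ∑' n, ∫⁻ t in cell x n, g t := by
  rw [hx.restrict_eq_sum, lintegral_sum_measure]

theorem enorm_sq {J : Set ℝ} (f : L2 J) : ‖f‖ₑ ^ 2 = ∫⁻ t in J, ‖f t‖ₑ ^ 2 := by
  have := eLpNorm_nnreal_pow_eq_lintegral (μ := volume.restrict J) (f := (f : ℝ → ℂ)) (p := 2)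
    two_ne_zero
  rw [Lp.enorm_def]
  simpa using this

theorem enorm_sq_eq_tsum (hx : IsPartition b x) (f : L2 (halfOpen b)) :
    ‖f‖ₑ ^ 2 = ∑' n, ‖hx.restrictCell n f‖ₑ ^ 2 := by
  rw [enorm_sq, hx.lintegral_eq_tsum]
  refine tsum_congr fun n => ?_
  rw [enorm_sq]
  refine lintegral_congr_ae ?_
  filter_upwards [hx.restrictCell_ae n f] with t ht
  rw [ht]

theorem hasSum_norm_sq (hx : IsPartition b x) (f : L2 (halfOpen b)) :
    HasSum (fun n => ‖hx.restrictCell n f‖ ^ 2) (‖f‖ ^ 2) := by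
  have h := hx.enorm_sq_eq_tsum f
  have hne : ∑' n, ‖hx.restrictCell n f‖ₑ ^ 2 ≠ ⊤ := by
    rw [← h]; exact ENNReal.pow_ne_top enorm_ne_top
  have h1 := ENNReal.hasSum_toReal hne
  rw [← ENNReal.tsum_toReal_eq (fun n => ENNReal.pow_ne_top enorm_ne_top), ← h] at h1
  simpa using h1

/-- The identification of `L²[0, b)` with the Hilbert direct sum of the spaces `L²[xₙ, xₙ₊₁]`,
as a linear isometry: `f` is sent to the sequence of its restrictions. -/
def decompIsometry (hx : IsPartition b x) :
    L2 (halfOpen b) →ₗᵢ[ℂ] lp (fun n => L2 (cell x n)) 2 where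
  toFun f := ⟨fun n => hx.restrictCell n f, memℓp_gen (by
    simpa using (hx.hasSum_norm_sq f).summable)⟩
  map_add' f g := by
    ext n : 2
    exact map_add (hx.restrictCell n) f g
  map_smul' c f := by
    ext n : 2
    exact map_smul (hx.restrictCell n) c f
  norm_map' f := by
    refine (sq_eq_sq₀ (norm_nonneg _) (norm_nonneg _)).1 ?_
    have h := lp.norm_rpow_eq_tsum (p := 2) (by norm_num)
      (⟨fun n => hx.restrictCell n f, memℓp_gen (by
        simpa using (hx.hasSum_norm_sq f).summable)⟩ : lp (fun n => L2 (cell x n)) 2)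
    have h2 := (hx.hasSum_norm_sq f).tsum_eq
    simp only [ENNReal.toReal_ofNat, Real.rpow_ofNat] at h
    exact h.trans h2

theorem decompIsometry_surjective (hx : IsPartition b x) :
    Function.Surjective hx.decompIsometry := by
  intro g
  classical
  let F : ℝ → ℂ := fun t =>
    if h : ∃ n, t ∈ Ico (x n) (x (n + 1)) then (g h.choose : ℝ → ℂ) t else 0
  have hF : ∀ n, F =ᵐ[volume.restrict (cell x n)] g n := by
    intro n
    have h1 : ∀ᵐ t ∂volume.restrict (cell x n), t ∈ Ico (x n) (x (n + 1)) := by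
      rw [cell, ← restrict_Ico_eq_restrict_Icc]
      exact ae_restrict_mem measurableSet_Ico
    filter_upwards [h1] with t ht
    have hex : ∃ n, t ∈ Ico (x n) (x (n + 1)) := ⟨n, ht⟩
    have hn : hex.choose = n := by
      have hc := hex.choose_spec
      rcases lt_trichotomy hex.choose n with h | h | h
      · exact absurd (hc.2.trans_le (hx.strictMono.monotone (Nat.succ_le_of_lt h)))
          (not_lt.2 ht.1)
      · exact h
      · exact absurd (ht.2.trans_le (hx.strictMono.monotone (Nat.succ_le_of_lt h)))
          (not_lt.2 hc.1)
    have hFt : F t = (g hex.choose : ℝ → ℂ) t := dif_pos hex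
    rw [hFt, hn]
  have hmeas : AEStronglyMeasurable F (volume.restrict (halfOpen b)) := by
    rw [← hx.iUnion_cell, aestronglyMeasurable_iUnion_iff]
    exact fun n => (Lp.aestronglyMeasurable (g n)).congr (hF n).symm
  have hsum : ∫⁻ t in halfOpen b, ‖F t‖ₑ ^ 2 < ⊤ := by
    have h1 : ∫⁻ t in halfOpen b, ‖F t‖ₑ ^ 2 = ∑' n, ENNReal.ofReal (‖g n‖ ^ 2) := by
      rw [hx.lintegral_eq_tsum]
      refine tsum_congr fun n => ?_
      rw [ENNReal.ofReal_pow (norm_nonneg _), ofReal_norm, enorm_sq]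
      refine lintegral_congr_ae ?_
      filter_upwards [hF n] with t ht
      rw [ht]
    have h2 : Summable fun n => ‖g n‖ ^ 2 := by
      simpa using (lp.memℓp g).summable (by norm_num)
    rw [h1, ← ENNReal.ofReal_tsum_of_nonneg (fun n => by positivity) h2]
    exact ENNReal.ofReal_lt_top
  have hmem : MemLp F 2 (volume.restrict (halfOpen b)) := by
    refine ⟨hmeas, ?_⟩
    have := eLpNorm_nnreal_pow_eq_lintegral (μ := volume.restrict (halfOpen b)) (f := F) (p := 2)
      two_ne_zero
    have h2 : eLpNorm F 2 (volume.restrict (halfOpen b)) ^ 2 < ⊤ := by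
      have h3 : eLpNorm F 2 (volume.restrict (halfOpen b)) ^ 2 =
          ∫⁻ t in halfOpen b, ‖F t‖ₑ ^ 2 := by simpa using this
      rw [h3]; exact hsum
    exact (ENNReal.pow_lt_top_iff.1 h2).resolve_right two_ne_zero
  refine ⟨hmem.toLp F, ?_⟩
  ext n : 2
  refine Lp.ext ?_
  refine (hx.restrictCell_ae n _).trans (EventuallyEq.trans ?_ (hF n))
  exact ae_restrict_of_ae_restrict_of_subset (hx.cell_subset n) hmem.coeFn_toLp

/-- The unitary identification of `L²[0, b)` with the Hilbert direct sum of the `L²[xₙ, xₙ₊₁]`;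
it sends `f` to the sequence of the restrictions of `f`. -/
def decomp (hx : IsPartition b x) :
    L2 (halfOpen b) ≃ₗᵢ[ℂ] lp (fun n => L2 (cell x n)) 2 :=
  LinearIsometryEquiv.ofSurjective hx.decompIsometry hx.decompIsometry_surjective

/-- The minimal operator `H_min = -d²/dx²` in `L²[0, b)`, with domain the set of all
`f ∈ W^{2,2}[0, b)` such that `f(xₙ) = f'(xₙ) = 0` for all `n ≥ 0`. -/
def Hmin (hx : IsPartition b x) : L2 (halfOpen b) →ₗ.[ℂ] L2 (halfOpen b) :=
  minimalOperator hx.isInterval (range x)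

/-- The minimal operator `Hₙ = -d²/dx²` in `L²[xₙ, xₙ₊₁]`, with domain `W^{2,2}_0[xₙ, xₙ₊₁]`. -/
def cellOperator (hx : IsPartition b x) (n : ℕ) : L2 (cell x n) →ₗ.[ℂ] L2 (cell x n) :=
  intervalOperator (hx.step n)

/-- The direct sum `⊕ₙ Γₙ` of boundary maps on the cells, as a map from `L²[0, b)`, with domain
`{f ∈ dom H_min† | ∑ ‖Γₙ fₙ‖² < ∞}`, where `fₙ` is the restriction of `f` to the `n`-th cell. -/
def boundarySum (hx : IsPartition b x)
    (Γ : ∀ n, L2 (cell x n) →ₗ.[ℂ] EuclideanSpace ℂ (Fin 2)) :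
    L2 (halfOpen b) →ₗ.[ℂ] lp (fun _ : ℕ => EuclideanSpace ℂ (Fin 2)) 2 :=
  (pullback (directSum Γ) hx.decomp.toLinearEquiv.toLinearMap).domRestrict hx.Hmin.adjoint.domain

end IsPartition

end BoundaryTriplets

end

open BoundaryTriplets

/-! On a single cell everything reduces to elementary calculus; the real content is uniformity in
`n`. The direct sum of the boundary maps must be defined on all of `dom H_min†`, be bounded there,
and map onto `ℓ² ⊕ ℓ²`, even when the lengths `d` of the cells have infimum zero.

The key observation is that one estimate yields all of this. Suppose that any data `(h₀, h₁)` are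
attained by some `f` with `‖f‖² + ‖f''‖² ≤ C (‖h₀‖² + ‖h₁‖²)`. Testing Green's identity against such
a function with one vanishing component gives, by Cauchy–Schwarz, boundedness of `Γ₀` and `Γ₁` with
the same `C`. If `C` does not depend on the cell, the maps of the direct sum are bounded and
everywhere defined on the adjoint's domain, and preimages chosen cell by cell assemble to an `ℓ²`
family (`IsTripletWithBound.directSum`).

The preimages are cubic polynomials (`exists_cubic`). In both triplets `Γ₁` annihilates affine
functions, so an affine part carries `h₀` and a cubic correction with `Γ₀ = 0` carries `h₁`. The
powers of `d` in the boundary maps are exactly those for which the affine part has norm of order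
`‖h₀‖`, the correction has norm of order `d² ‖h₁‖`, and the second derivative has norm of order
`‖h₁‖`. No negative power of `d` remains, so an upper bound on `d` suffices.

The operator theory on a cell rests on the fact that a function orthogonal to the range of the
minimal operator is affine (`exists_isRep_zero_of_orthogonal`), which gives both density and the
adjoint. That `H_min` is the direct sum of the cell operators is a gluing statement
(`exists_isRep_of_cells`), and the adjoint of a direct sum is the direct sum of the adjoints. -/

namespace AbsolutelyContinuousOnInterval

/-! ### Absolutely continuous complex-valued functions -/

/-- Absolute continuity sees only distances between values, so it passes through conjugation, the
embedding of the reals, and the addition of constants. -/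
theorem of_dist_le {X Y : Type*} [PseudoMetricSpace X] [PseudoMetricSpace Y] {f : ℝ → X}
    {g : ℝ → Y} {a b : ℝ} (hf : AbsolutelyContinuousOnInterval f a b)
    (h : ∀ s ∈ uIcc a b, ∀ t ∈ uIcc a b, dist (g s) (g t) ≤ dist (f s) (f t)) :
    AbsolutelyContinuousOnInterval g a b := by
  rw [absolutelyContinuousOnInterval_iff] at hf ⊢
  intro ε hε
  obtain ⟨δ, hδ, H⟩ := hf ε hε
  refine ⟨δ, hδ, fun E hE hEδ => lt_of_le_of_lt (Finset.sum_le_sum fun i hi => ?_) (H E hE hEδ)⟩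
  exact h _ (hE.1 i hi).1 _ (hE.1 i hi).2

theorem congr {X : Type*} [PseudoMetricSpace X] {f g : ℝ → X} {a b : ℝ}
    (hf : AbsolutelyContinuousOnInterval f a b) (h : EqOn f g (uIcc a b)) :
    AbsolutelyContinuousOnInterval g a b :=
  hf.of_dist_le fun s hs t ht => by rw [h hs, h ht]

theorem integral_complex {f : ℝ → ℂ} {a b c : ℝ} (h : IntervalIntegrable f volume a b)
    (hc : c ∈ uIcc a b) : AbsolutelyContinuousOnInterval (fun x => ∫ t in c..x, f t) a b := by
  have hre : IntervalIntegrable (fun t => (f t).re) volume a b := ⟨h.1.re, h.2.re⟩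
  have him : IntervalIntegrable (fun t => (f t).im) volume a b := ⟨h.1.im, h.2.im⟩
  have h1 := hre.absolutelyContinuousOnInterval_intervalIntegral hc
  have h2 := him.absolutelyContinuousOnInterval_intervalIntegral hc
  have h1' : AbsolutelyContinuousOnInterval
      (fun x => ((∫ t in c..x, (f t).re : ℝ) : ℂ)) a b :=
    h1.of_dist_le fun s _ t _ => by rw [Complex.dist_of_im_eq] <;> simp
  have h2' : AbsolutelyContinuousOnInterval
      (fun x => ((∫ t in c..x, (f t).im : ℝ) : ℂ)) a b :=
    h2.of_dist_le fun s _ t _ => by rw [Complex.dist_of_im_eq] <;> simp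
  refine (h1'.add (h2'.const_smul Complex.I)).congr fun x hx => ?_
  have hsub : uIcc c x ⊆ uIcc a b := uIcc_subset_uIcc hc hx
  have hr' := hre.mono_set hsub
  have hi' := him.mono_set hsub
  have hr'' : IntervalIntegrable (fun t => ((f t).re : ℂ)) volume c x := ⟨hr'.1.ofReal, hr'.2.ofReal⟩
  have hi'' : IntervalIntegrable (fun t => ((f t).im : ℂ)) volume c x := ⟨hi'.1.ofReal, hi'.2.ofReal⟩
  simp only [Pi.add_apply, smul_eq_mul]
  rw [← intervalIntegral.integral_ofReal, ← intervalIntegral.integral_ofReal,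
    ← intervalIntegral.integral_const_mul, ← intervalIntegral.integral_add hr'' (hi''.const_mul _)]
  refine intervalIntegral.integral_congr fun t _ => ?_
  rw [mul_comm]
  exact Complex.re_add_im (f t)

/-- The fundamental theorem of calculus for complex-valued absolutely continuous functions. -/
theorem integral_eq_sub_of_ae_hasDerivAt {f f' : ℝ → ℂ} {a b : ℝ}
    (hf : AbsolutelyContinuousOnInterval f a b) (hi : IntervalIntegrable f' volume a b)
    (hd : ∀ᵐ x, x ∈ uIcc a b → HasDerivAt f (f' x) x) : ∫ x in a..b, f' x = f b - f a := by
  have hac := integral_complex hi left_mem_uIcc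
  -- The difference of `f` and the primitive of `f'` is absolutely continuous with derivative zero
  -- almost everywhere, hence constant.
  obtain ⟨C, hC⟩ := (hf.sub hac).const_of_ae_hasDerivAt_zero (by
    filter_upwards [hd, hi.ae_hasDerivAt_integral] with x h1 h2 hx
    simpa using (h1 hx).sub (h2 hx a left_mem_uIcc))
  have h1 := hC a left_mem_uIcc
  have h2 := hC b right_mem_uIcc
  simp only [Pi.sub_apply, intervalIntegral.integral_same, sub_zero] at h1 h2
  rw [← h1] at h2
  linear_combination -h2

end AbsolutelyContinuousOnInterval

namespace BoundaryTriplets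

/-! ### Sobolev functions as double primitives, and Green's identity -/

theorem IsInterval.uIcc_subset {J : Set ℝ} (hJ : IsInterval J) {s t : ℝ} (hs : s ∈ J)
    (ht : t ∈ J) : uIcc s t ⊆ J := by
  have := hJ.convex.ordConnected
  exact this.uIcc_subset hs ht

theorem L2.intervalIntegrable {J : Set ℝ} (hJ : IsInterval J) (w : L2 J) {s t : ℝ} (hs : s ∈ J)
    (ht : t ∈ J) : IntervalIntegrable w volume s t := by
  rw [intervalIntegrable_iff]
  have h1 : MemLp w 2 (volume.restrict (uIoc s t)) := (Lp.memLp w).mono_measure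
    (Measure.restrict_mono (uIoc_subset_uIcc.trans (hJ.uIcc_subset hs ht)) le_rfl)
  have : IsFiniteMeasure (volume.restrict (uIoc s t)) := by
    rw [uIoc]; infer_instance
  exact h1.integrable one_le_two

/-- Almost everywhere in `[s, t] ⊆ J`, derivatives within `J` are derivatives. -/
theorem ae_hasDerivAt_of_within {J : Set ℝ} (hJ : IsInterval J) {f f' : ℝ → ℂ}
    (h : ∀ᵐ x ∂volume.restrict J, HasDerivWithinAt f (f' x) J x) {s t : ℝ} (hs : s ∈ J)
    (ht : t ∈ J) : ∀ᵐ x, x ∈ uIcc s t → HasDerivAt f (f' x) x := by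
  have h1 := (ae_restrict_iff'₀ (hJ.convex.nullMeasurableSet volume)).1 h
  have hsub := hJ.uIcc_subset hs ht
  filter_upwards [h1, (measure_eq_zero_iff_ae_notMem.1 (measure_singleton s) : ∀ᵐ x, x ∉ ({s} : Set ℝ)),
    (measure_eq_zero_iff_ae_notMem.1 (measure_singleton t) : ∀ᵐ x, x ∉ ({t} : Set ℝ))]
    with x hx hxs hxt hxm
  refine (hx (hsub hxm)).hasDerivAt (mem_of_superset ?_ hsub)
  simp only [mem_singleton_iff] at hxs hxt
  rw [uIcc] at hxm ⊢
  refine Icc_mem_nhds (lt_of_le_of_ne hxm.1 ?_) (lt_of_le_of_ne hxm.2 ?_)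
  · rcases min_choice s t with h | h <;> rw [h] <;> [exact Ne.symm hxs; exact Ne.symm hxt]
  · rcases max_choice s t with h | h <;> rw [h] <;> assumption

namespace IsRep

variable {J : Set ℝ} {f : L2 J} {u v : ℝ → ℂ} {w : L2 J}

theorem integral_deriv_deriv (h : IsRep J f u v w) (hJ : IsInterval J) {s t : ℝ} (hs : s ∈ J)
    (ht : t ∈ J) : ∫ x in s..t, w x = v t - v s :=
  (h.ac_deriv s hs t ht).integral_eq_sub_of_ae_hasDerivAt (L2.intervalIntegrable hJ w hs ht)
    (ae_hasDerivAt_of_within hJ h.hasDeriv_deriv hs ht)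

theorem intervalIntegrable_deriv (h : IsRep J f u v w) {s t : ℝ} (hs : s ∈ J)
    (ht : t ∈ J) : IntervalIntegrable v volume s t :=
  (h.ac_deriv s hs t ht).continuousOn.intervalIntegrable

theorem integral_deriv (h : IsRep J f u v w) (hJ : IsInterval J) {s t : ℝ} (hs : s ∈ J)
    (ht : t ∈ J) : ∫ x in s..t, v x = u t - u s :=
  (h.ac s hs t ht).integral_eq_sub_of_ae_hasDerivAt (h.intervalIntegrable_deriv hs ht)
    (ae_hasDerivAt_of_within hJ ((ae_restrict_iff'₀ (hJ.convex.nullMeasurableSet volume)).2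
      (Eventually.of_forall h.hasDeriv)) hs ht)

/-- A function given by integrating `w ∈ L²(J)` twice belongs to `W^{2,2}(J)` as soon as it is in
`L²(J)`. -/
theorem of_integral (hJ : IsInterval J) {a : ℝ} (ha : a ∈ J)
    (hf : f =ᵐ[volume.restrict J] u) (hu : ∀ t ∈ J, u t = u a + ∫ x in a..t, v x)
    (hv : ∀ t ∈ J, v t = v a + ∫ x in a..t, w x) : IsRep J f u v w := by
  -- The values of `w` off `J` are arbitrary. Cutting it off outside a measurable `J' ⊇ J` gives an
  -- `L²` function on the whole line, so `u'` and `v'` below are global primitives and the end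
  -- points of `J` need no separate treatment.
  obtain ⟨J', hJ'J, hJ', hJJ'⟩ :=
    (hJ.convex.nullMeasurableSet volume).exists_measurable_superset_ae_eq
  set w' : ℝ → ℂ := J'.indicator w with hw'
  have hres : volume.restrict J' = volume.restrict J := Measure.restrict_congr_set hJJ'
  have hw2 : MemLp w' 2 volume := by
    rw [hw', memLp_indicator_iff_restrict hJ', hres]
    exact Lp.memLp w
  have hloc : LocallyIntegrable w' volume := hw2.locallyIntegrable one_le_two
  have hint : ∀ s t, IntervalIntegrable w' volume s t := fun s t =>
    intervalIntegrable_iff.2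
      ((hloc.integrableOn_isCompact isCompact_uIcc).mono_set uIoc_subset_uIcc)
  set v' : ℝ → ℂ := fun t => v a + ∫ x in a..t, w' x with hv'
  have hvc : Continuous v' := continuous_const.add
    (intervalIntegral.continuous_primitive hint a)
  have hvv : EqOn v' v J := fun t ht => by
    rw [hv t ht]
    refine congrArg (v a + ·) ?_
    refine intervalIntegral.integral_congr fun x hx => ?_
    exact indicator_of_mem (hJ'J (hJ.uIcc_subset ha ht hx)) _
  set u' : ℝ → ℂ := fun t => u a + ∫ x in a..t, v' x with hu'
  have huu : EqOn u' u J := fun t ht => by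
    rw [hu t ht]
    refine congrArg (u a + ·) ?_
    exact intervalIntegral.integral_congr fun x hx => hvv (hJ.uIcc_subset ha ht hx)
  have hud : ∀ t, HasDerivAt u' (v' t) t := fun t =>
    (intervalIntegral.integral_hasDerivAt_right (hvc.intervalIntegrable _ _)
      (hvc.stronglyMeasurableAtFilter _ _) hvc.continuousAt).const_add _
  have hac : ∀ {g : ℝ → ℂ} (c : ℂ), (∀ s t, IntervalIntegrable g volume s t) → ∀ s t,
      AbsolutelyContinuousOnInterval (fun t => c + ∫ x in a..t, g x) s t := by
    intro g c hg s t
    have h1 := AbsolutelyContinuousOnInterval.integral_complex (hg s t) left_mem_uIcc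
    refine h1.of_dist_le fun p _ q _ => le_of_eq ?_
    rw [dist_eq_norm, dist_eq_norm]
    congr 1
    rw [← intervalIntegral.integral_add_adjacent_intervals (hg a s) (hg s p),
      ← intervalIntegral.integral_add_adjacent_intervals (hg a s) (hg s q)]
    ring
  refine ⟨hf, ?_, ?_, ?_, ?_⟩
  · intro s hs t ht
    exact (hac (u a) (fun _ _ => hvc.intervalIntegrable _ _) s t).congr
      (huu.mono (hJ.uIcc_subset hs ht))
  · intro t ht
    rw [← hvv ht]
    exact (hud t).hasDerivWithinAt.congr (fun x hx => (huu hx).symm) (huu ht).symm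
  · intro s hs t ht
    exact (hac (v a) hint s t).congr (hvv.mono (hJ.uIcc_subset hs ht))
  · filter_upwards [ae_restrict_of_ae (LocallyIntegrable.ae_hasDerivAt_integral hloc),
      ae_restrict_mem₀ (hJ.convex.nullMeasurableSet volume)] with t h1 ht
    have h2 := (h1 a).const_add (v a)
    rw [hw', indicator_of_mem (hJ'J ht)] at h2
    exact h2.hasDerivWithinAt.congr (fun x hx => (hvv hx).symm) (hvv ht).symm

end IsRep

/-- Every `w ∈ L²[a, b]` is the second derivative of a function in `W^{2,2}[a, b]` with prescribed
initial values. -/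
theorem exists_isRep_Icc {a b : ℝ} (hab : a < b) (w : L2 (Icc a b)) (α β : ℂ) :
    ∃ f u v, IsRep (Icc a b) f u v w ∧ u a = α ∧ v a = β := by
  have hJ := isInterval_Icc hab
  have ha := left_mem_Icc.2 hab.le
  have hb := right_mem_Icc.2 hab.le
  set v : ℝ → ℂ := fun t => β + ∫ x in a..t, w x with hv
  set u : ℝ → ℂ := fun t => α + ∫ x in a..t, v x with hu
  have hva : v a = β := by simp [hv]
  have hua : u a = α := by simp [hu]
  have hvc : ContinuousOn v (uIcc a b) := continuousOn_const.add
    (AbsolutelyContinuousOnInterval.integral_complex (L2.intervalIntegrable hJ w ha hb)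
      left_mem_uIcc).continuousOn
  have huc : ContinuousOn u (uIcc a b) := continuousOn_const.add
    (AbsolutelyContinuousOnInterval.integral_complex hvc.intervalIntegrable
      left_mem_uIcc).continuousOn
  rw [uIcc_of_le hab.le] at huc
  have hm : MemLp u 2 (volume.restrict (Icc a b)) := by
    obtain ⟨C, hC⟩ := isCompact_Icc.exists_bound_of_continuousOn huc
    refine MemLp.of_bound (huc.aestronglyMeasurable measurableSet_Icc) C ?_
    filter_upwards [ae_restrict_mem measurableSet_Icc] with t ht using hC t ht
  refine ⟨hm.toLp u, u, v, IsRep.of_integral hJ ha hm.coeFn_toLp ?_ ?_, hua, hva⟩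
  · intro t _; rw [hua]
  · intro t _; rw [hva]

/-- Green's identity on `[a, b]`. -/
theorem IsRep.green {a b : ℝ} (hab : a < b) {f g w z : L2 (Icc a b)} {u v p q : ℝ → ℂ}
    (hf : IsRep (Icc a b) f u v w) (hg : IsRep (Icc a b) g p q z) :
    inner ℂ g w - inner ℂ z f =
      (star (p b) * v b - star (q b) * u b) - (star (p a) * v a - star (q a) * u a) := by
  have hJ := isInterval_Icc hab
  have ha := left_mem_Icc.2 hab.le
  have hb := right_mem_Icc.2 hab.le
  have hstar : ∀ {g : ℝ → ℂ}, AbsolutelyContinuousOnInterval g a b →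
      AbsolutelyContinuousOnInterval (fun t => star (g t)) a b := fun hg =>
    hg.of_dist_le fun s _ t _ => by
      rw [dist_eq_norm, dist_eq_norm, ← star_sub, norm_star]
  -- The Wronskian `p̄ v - q̄ u`. In its derivative the terms `q̄ v` cancel, leaving the difference
  -- of the two integrands.
  have hac := ((hstar (hg.ac a ha b hb)).smul (hf.ac_deriv a ha b hb)).sub
    ((hstar (hg.ac_deriv a ha b hb)).smul (hf.ac a ha b hb))
  have hi1 : IntegrableOn (fun t => inner ℂ (g t) (w t)) (Icc a b) := L2.integrable_inner g w
  have hi2 : IntegrableOn (fun t => inner ℂ (z t) (f t)) (Icc a b) := L2.integrable_inner z f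
  have hi : IntervalIntegrable (fun t => inner ℂ (g t) (w t) - inner ℂ (z t) (f t)) volume a b := by
    rw [intervalIntegrable_iff_integrableOn_Icc_of_le hab.le]
    exact hi1.sub hi2
  have key := hac.integral_eq_sub_of_ae_hasDerivAt hi (by
    have h1 := ae_hasDerivAt_of_within hJ hf.hasDeriv_deriv ha hb
    have h2 := ae_hasDerivAt_of_within hJ hg.hasDeriv_deriv ha hb
    have h3 := ae_hasDerivAt_of_within hJ ((ae_restrict_iff' measurableSet_Icc).2
      (Eventually.of_forall hf.hasDeriv)) ha hb
    have h4 := ae_hasDerivAt_of_within hJ ((ae_restrict_iff' measurableSet_Icc).2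
      (Eventually.of_forall hg.hasDeriv)) ha hb
    have h5 := (ae_restrict_iff' measurableSet_Icc).1 hf.ae_eq
    have h6 := (ae_restrict_iff' measurableSet_Icc).1 hg.ae_eq
    filter_upwards [h1, h2, h3, h4, h5, h6] with t h1 h2 h3 h4 h5 h6 ht
    have ht' : t ∈ Icc a b := by rwa [uIcc_of_le hab.le] at ht
    have hd := ((h4 ht).star.mul (h1 ht)).sub ((h2 ht).star.mul (h3 ht))
    refine hd.congr_deriv ?_
    rw [h5 ht', h6 ht', RCLike.inner_apply, RCLike.inner_apply, starRingEnd_apply,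
      starRingEnd_apply]
    ring)
  rw [MeasureTheory.L2.inner_def, MeasureTheory.L2.inner_def, ← integral_sub hi1 hi2, integral_Icc_eq_integral_Ioc,
    ← intervalIntegral.integral_of_le hab.le, key]
  simp [Pi.sub_apply]

/-- By uniqueness of representatives, any `IsRep` witness describes the operator, so the chosen
`rep`, `repDeriv` and `secondDeriv` can be avoided. -/
theorem mem_graph_negSecondDeriv {J : Set ℝ} (hJ : IsInterval J) {f g : L2 J} :
    (f, g) ∈ (negSecondDeriv hJ).graph ↔ ∃ u v, IsRep J f u v (-g) := by
  rw [LinearPMap.mem_graph_iff]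
  constructor
  · rintro ⟨y, hy, hg⟩
    have h := isRep y
    have hg' : -secondDeriv y = g := hg
    rw [← hg', neg_neg, ← show (y : L2 J) = f from hy]
    exact ⟨_, _, h⟩
  · rintro ⟨u, v, h⟩
    refine ⟨⟨f, ⟨u, v, _, h⟩⟩, rfl, ?_⟩
    have h1 := ((isRep (⟨f, ⟨u, v, _, h⟩⟩ : W22 J)).unique hJ h).2.2
    change -secondDeriv (⟨f, ⟨u, v, _, h⟩⟩ : W22 J) = g
    rw [h1, neg_neg]

theorem mem_graph_minimalOperator {J : Set ℝ} (hJ : IsInterval J) {X : Set ℝ} {f g : L2 J} :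
    (f, g) ∈ (minimalOperator hJ X).graph ↔
      ∃ u v, IsRep J f u v (-g) ∧ ∀ t ∈ X, u t = 0 ∧ v t = 0 := by
  constructor
  · intro h
    have h1 : (f, g) ∈ (negSecondDeriv hJ).graph :=
      LinearPMap.le_graph_of_le LinearPMap.domRestrict_le h
    obtain ⟨u, v, h2⟩ := (mem_graph_negSecondDeriv hJ).1 h1
    obtain ⟨y, hy, -⟩ := (LinearPMap.mem_graph_iff _).1 h
    obtain ⟨u', v', w', h3, h4⟩ := y.2.1
    rw [show (y : L2 J) = f from hy] at h3
    rw [← (h3.unique hJ h2).2.2]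
    exact ⟨u', v', h3, h4⟩
  · rintro ⟨u, v, h, h0⟩
    have h1 := (mem_graph_negSecondDeriv hJ).2 ⟨u, v, h⟩
    obtain ⟨y, hy, hg⟩ := (LinearPMap.mem_graph_iff _).1 h1
    dsimp only at hy hg
    subst hy
    have hmem : (y : L2 J) ∈ (minimalOperator hJ X).domain := ⟨⟨u, v, _, h, h0⟩, y.2⟩
    refine (LinearPMap.mem_graph_iff _).2 ⟨⟨y, hmem⟩, rfl, ?_⟩
    rw [← hg]
    exact LinearPMap.domRestrict_apply rfl

/-- A twice continuously differentiable function, as an element of `W^{2,2}[a, b]`. -/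
theorem exists_isRep_of_hasDerivAt {a b : ℝ} (hab : a < b) {u v w : ℝ → ℂ}
    (hu : ∀ t, HasDerivAt u (v t) t) (hv : ∀ t, HasDerivAt v (w t) t) (hw : Continuous w) :
    ∃ f z, IsRep (Icc a b) f u v z ∧ f =ᵐ[volume.restrict (Icc a b)] u ∧
      z =ᵐ[volume.restrict (Icc a b)] w := by
  have hm : ∀ {g : ℝ → ℂ}, Continuous g → MemLp g 2 (volume.restrict (Icc a b)) := by
    intro g hg
    obtain ⟨C, hC⟩ := isCompact_Icc.exists_bound_of_continuousOn (hg.continuousOn (s := Icc a b))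
    refine MemLp.of_bound hg.aestronglyMeasurable C ?_
    filter_upwards [ae_restrict_mem measurableSet_Icc] with t ht using hC t ht
  have huc : Continuous u := continuous_iff_continuousAt.2 fun t => (hu t).continuousAt
  have hvc : Continuous v := continuous_iff_continuousAt.2 fun t => (hv t).continuousAt
  have hJ := isInterval_Icc hab
  have ha := left_mem_Icc.2 hab.le
  refine ⟨(hm huc).toLp u, (hm hw).toLp w, IsRep.of_integral hJ ha (hm huc).coeFn_toLp ?_ ?_,
    (hm huc).coeFn_toLp, (hm hw).coeFn_toLp⟩
  · intro t _
    rw [intervalIntegral.integral_eq_sub_of_hasDerivAt (fun x _ => hu x)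
      (hvc.intervalIntegrable _ _)]
    ring
  · intro t ht
    have h1 : ∫ x in a..t, ((hm hw).toLp w) x = ∫ x in a..t, w x := by
      refine intervalIntegral.integral_congr_ae ?_
      filter_upwards [(ae_restrict_iff' measurableSet_Icc).1 (hm hw).coeFn_toLp] with x hx hxm
      exact hx (hJ.uIcc_subset ha ht (uIoc_subset_uIcc hxm))
    rw [h1, intervalIntegral.integral_eq_sub_of_hasDerivAt (fun x _ => hv x)
      (hw.intervalIntegrable _ _)]
    ring

/-! ### The minimal operator on one cell: density and adjoint -/

section Cell

variable {a b : ℝ} (hab : a < b)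

/-- The orthogonal complement of the range of the minimal operator consists of affine functions. -/
theorem exists_isRep_zero_of_orthogonal {f : L2 (Icc a b)}
    (hf : ∀ p q, (p, q) ∈ (intervalOperator hab).graph → inner ℂ q f = 0) :
    ∃ u v, IsRep (Icc a b) f u v 0 := by
  obtain ⟨e₀, z₀, h₀, -, hz₀⟩ := exists_isRep_of_hasDerivAt hab (u := fun _ => (1 : ℂ))
    (v := fun _ => 0) (w := fun _ => 0) (fun t => hasDerivAt_const _ _)
    (fun t => hasDerivAt_const _ _) continuous_const
  -- The linear function is centred at `b`, so that Green's identity against it isolates the value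
  -- at `b`, while the constant function isolates the derivative there.
  obtain ⟨e₁, z₁, h₁, -, hz₁⟩ := exists_isRep_of_hasDerivAt hab (u := fun t => ((t - b : ℝ) : ℂ))
    (v := fun _ => 1) (w := fun _ => 0)
    (fun t => by simpa using ((hasDerivAt_id t).sub_const b).ofReal_comp)
    (fun t => hasDerivAt_const _ _) continuous_const
  have hz : ∀ {z : L2 (Icc a b)}, z =ᵐ[volume.restrict (Icc a b)] (fun _ => (0 : ℂ)) → z = 0 :=
    fun h => Lp.ext (h.trans (Lp.coeFn_zero _ _ _).symm)
  rw [hz hz₀] at h₀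
  rw [hz hz₁] at h₁
  -- Every `w ⟂ K` lies in the range: the solution of `φ'' = w` with zero data at `a` also has zero
  -- data at `b`. Hence `f ∈ Kᗮᗮ`, which is `K` by finite dimension.
  let K : Submodule ℂ (L2 (Icc a b)) := Submodule.span ℂ {e₀, e₁}
  have hK : f ∈ Kᗮᗮ := by
    intro w hw
    obtain ⟨φ, u, v, h, hu, hv⟩ := exists_isRep_Icc hab w 0 0
    have hw₀ : inner ℂ e₀ w = 0 := hw _ (Submodule.subset_span (by simp))
    have hw₁ : inner ℂ e₁ w = 0 := hw _ (Submodule.subset_span (by simp))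
    have g₀ := h.green hab h₀
    have g₁ := h.green hab h₁
    rw [hw₀, inner_zero_left, hu, hv] at g₀
    rw [hw₁, inner_zero_left, hu, hv] at g₁
    simp only [star_one, star_zero, sub_self, Complex.ofReal_zero, zero_mul, mul_zero, one_mul,
      sub_zero, zero_sub] at g₀ g₁
    have hmem : (φ, -w) ∈ (intervalOperator hab).graph := by
      refine (mem_graph_minimalOperator _).2 ⟨u, v, by rwa [neg_neg], ?_⟩
      rintro t (rfl | rfl)
      · exact ⟨hu, hv⟩
      · exact ⟨neg_eq_zero.1 g₁.symm, g₀.symm⟩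
    have := hf _ _ hmem
    rwa [inner_neg_left, neg_eq_zero] at this
  have : FiniteDimensional ℂ K := FiniteDimensional.span_of_finite ℂ (by simp)
  rw [Submodule.orthogonal_orthogonal] at hK
  obtain ⟨α, β, rfl⟩ := Submodule.mem_span_pair.1 hK
  have h := (h₀.smul α).add (h₁.smul β)
  simp only [smul_zero, add_zero] at h
  exact ⟨_, _, h⟩

theorem inner_graph_intervalOperator {f g φ ψ : L2 (Icc a b)}
    (hf : (f, g) ∈ (negSecondDeriv (isInterval_Icc hab)).graph)
    (hφ : (φ, ψ) ∈ (intervalOperator hab).graph) : inner ℂ ψ f = inner ℂ φ g := by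
  obtain ⟨u, v, h⟩ := (mem_graph_negSecondDeriv _).1 hf
  obtain ⟨p, q, h', h0⟩ := (mem_graph_minimalOperator _).1 hφ
  have hg := h.green hab h'
  have h0a := h0 a (by simp)
  have h0b := h0 b (by simp)
  rw [h0a.1, h0a.2, h0b.1, h0b.2, inner_neg_right, inner_neg_left] at hg
  simp only [star_zero, zero_mul, sub_self] at hg
  linear_combination hg

/-- If `f` is orthogonal to the domain, a solution of `-h'' = f` is orthogonal to the range, hence
affine, and so `f = 0`. -/
theorem dense_intervalOperator : Dense ((intervalOperator hab).domain : Set (L2 (Icc a b))) := by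
  rw [Submodule.dense_iff_topologicalClosure_eq_top, Submodule.topologicalClosure_eq_top_iff,
    Submodule.eq_bot_iff]
  intro f hf
  obtain ⟨h, u, v, hr, -, -⟩ := exists_isRep_Icc hab (-f) 0 0
  obtain ⟨u', v', hr'⟩ := exists_isRep_zero_of_orthogonal hab (f := h) fun p q hpq => by
    rw [inner_graph_intervalOperator hab ((mem_graph_negSecondDeriv _).2 ⟨u, v, hr⟩) hpq]
    exact hf _ (LinearPMap.mem_domain_of_mem_graph hpq)
  exact neg_eq_zero.1 (hr.unique (isInterval_Icc hab) hr').2.2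

theorem mem_graph_adjoint {E F : Type*} [NormedAddCommGroup E] [InnerProductSpace ℂ E]
    [NormedAddCommGroup F] [InnerProductSpace ℂ F] [CompleteSpace E] {T : E →ₗ.[ℂ] F}
    (hT : Dense (T.domain : Set E)) {f : F} {g : E} :
    (f, g) ∈ T.adjoint.graph ↔ ∀ p q, (p, q) ∈ T.graph → inner ℂ q f = inner ℂ p g := by
  rw [LinearPMap.adjoint_graph_eq_graph_adjoint hT, Submodule.mem_adjoint_iff]
  simp only [sub_eq_zero]

/-- If `f` has adjoint image `g`, subtracting a solution of `-h'' = g` leaves a function orthogonal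
to the range, hence affine. So `f` is itself in `W^{2,2}`, without any regularity argument. -/
theorem adjoint_intervalOperator :
    (intervalOperator hab).adjoint = negSecondDeriv (isInterval_Icc hab) := by
  refine LinearPMap.eq_of_eq_graph (le_antisymm ?_ ?_)
  · rintro ⟨f, g⟩ hfg
    rw [mem_graph_adjoint (dense_intervalOperator hab)] at hfg
    obtain ⟨h, u, v, hr, -, -⟩ := exists_isRep_Icc hab (-g) 0 0
    obtain ⟨u', v', hr'⟩ := exists_isRep_zero_of_orthogonal hab (f := f - h) fun p q hpq => by
      rw [inner_sub_right, hfg p q hpq,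
        inner_graph_intervalOperator hab ((mem_graph_negSecondDeriv _).2 ⟨u, v, hr⟩) hpq, sub_self]
    have := hr'.add hr
    rw [sub_add_cancel, zero_add] at this
    exact (mem_graph_negSecondDeriv _).2 ⟨_, _, this⟩
  · rintro ⟨f, g⟩ hfg
    rw [mem_graph_adjoint (dense_intervalOperator hab)]
    exact fun p q hpq => inner_graph_intervalOperator hab hfg hpq

theorem intervalOperator_le_adjoint : intervalOperator hab ≤ (intervalOperator hab).adjoint := by
  rw [adjoint_intervalOperator]
  exact LinearPMap.domRestrict_le

end Cell

/-! ### Boundary triplets with a quantitative right inverse -/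

section Uniform

variable {E : Type*} [NormedAddCommGroup E] [InnerProductSpace ℂ E] [CompleteSpace E]
variable {H : Type*} [NormedAddCommGroup H] [InnerProductSpace ℂ H]

/-- A boundary triplet in terms of graphs, where boundedness of the boundary maps is replaced by a
right inverse of `(Γ₀, Γ₁)` whose square is bounded by `C` with respect to the graph norm. -/
structure IsTripletWithBound (A : E →ₗ.[ℂ] E) (Γ₀ Γ₁ : E →ₗ.[ℂ] H) (C : ℝ) : Prop where
  dense_domain : Dense (A.domain : Set E)
  isClosed : A.IsClosed
  symmetric : A ≤ A.adjoint
  dom₀ : Γ₀.domain = A.adjoint.domain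
  dom₁ : Γ₁.domain = A.adjoint.domain
  green : ∀ {f f' g g' : E} {f₀ f₁ g₀ g₁ : H}, (f, f') ∈ A.adjoint.graph →
    (g, g') ∈ A.adjoint.graph → (f, f₀) ∈ Γ₀.graph → (f, f₁) ∈ Γ₁.graph → (g, g₀) ∈ Γ₀.graph →
    (g, g₁) ∈ Γ₁.graph → inner ℂ g f' - inner ℂ g' f = inner ℂ g₀ f₁ - inner ℂ g₁ f₀
  surjective : ∀ h₀ h₁ : H, ∃ f f' : E, (f, f') ∈ A.adjoint.graph ∧ (f, h₀) ∈ Γ₀.graph ∧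
    (f, h₁) ∈ Γ₁.graph ∧ ‖f‖ ^ 2 + ‖f'‖ ^ 2 ≤ C * (‖h₀‖ ^ 2 + ‖h₁‖ ^ 2)

/-- An operator is closed if it is symmetric, Green's identity holds for its adjoint, and it
contains the common kernel of the boundary maps. -/
theorem isClosed_of_green {A : E →ₗ.[ℂ] E} {Γ₀ Γ₁ : E →ₗ.[ℂ] H}
    (hA : Dense (A.domain : Set E)) (hs : A ≤ A.adjoint) (dom₀ : Γ₀.domain = A.adjoint.domain)
    (dom₁ : Γ₁.domain = A.adjoint.domain)
    (green : ∀ {f f' g g' : E} {f₀ f₁ g₀ g₁ : H}, (f, f') ∈ A.adjoint.graph →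
      (g, g') ∈ A.adjoint.graph → (f, f₀) ∈ Γ₀.graph → (f, f₁) ∈ Γ₁.graph → (g, g₀) ∈ Γ₀.graph →
      (g, g₁) ∈ Γ₁.graph → inner ℂ g f' - inner ℂ g' f = inner ℂ g₀ f₁ - inner ℂ g₁ f₀)
    (surjective : ∀ h₀ h₁ : H, ∃ f f' : E, (f, f') ∈ A.adjoint.graph ∧ (f, h₀) ∈ Γ₀.graph ∧
      (f, h₁) ∈ Γ₁.graph)
    (hker : ∀ f f', (f, f') ∈ A.adjoint.graph → (f, 0) ∈ Γ₀.graph → (f, 0) ∈ Γ₁.graph →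
      (f, f') ∈ A.graph) : A.IsClosed := by
  -- The graph of `A` is cut out of the closed graph of `A†` by the continuous conditions that the
  -- boundary form against every element of `A†` vanishes.
  have heq : (A.graph : Set (E × E)) = (A.adjoint.graph : Set (E × E)) ∩
      ⋂ y : A.adjoint.graph, {x | inner ℂ y.1.1 x.2 - inner ℂ y.1.2 x.1 = 0} := by
    ext ⟨f, f'⟩
    simp only [mem_inter_iff, mem_iInter, SetLike.mem_coe, mem_ofPred_eq]
    constructor
    · intro h
      refine ⟨LinearPMap.le_graph_of_le hs h, ?_⟩
      rintro ⟨⟨g, g'⟩, hg⟩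
      have h1 := (mem_graph_adjoint hA).1 hg f f' h
      rw [← inner_conj_symm, h1, inner_conj_symm, sub_self]
    · rintro ⟨h, h'⟩
      obtain ⟨f₀, hf₀⟩ := LinearPMap.mem_domain_iff.1
        (dom₀.ge (LinearPMap.mem_domain_of_mem_graph h))
      obtain ⟨f₁, hf₁⟩ := LinearPMap.mem_domain_iff.1
        (dom₁.ge (LinearPMap.mem_domain_of_mem_graph h))
      -- With this choice the boundary form equals `‖f₁‖² + ‖f₀‖²`, so both boundary values are
      -- zero.
      obtain ⟨g, g', hg, hg₀, hg₁⟩ := surjective f₁ (-f₀)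
      have h1 := green h hg hf₀ hf₁ hg₀ hg₁
      have h2 := h' ⟨(g, g'), hg⟩
      rw [h2, inner_neg_left, sub_neg_eq_add, inner_self_eq_norm_sq_to_K,
        inner_self_eq_norm_sq_to_K] at h1
      have h3 : ‖f₁‖ ^ 2 + ‖f₀‖ ^ 2 = 0 := by
        exact Complex.ofReal_injective (by simpa using h1.symm)
      have h4 : f₀ = 0 := norm_eq_zero.1 (by nlinarith [sq_nonneg ‖f₁‖, sq_nonneg ‖f₀‖])
      have h5 : f₁ = 0 := norm_eq_zero.1 (by nlinarith [sq_nonneg ‖f₁‖, sq_nonneg ‖f₀‖])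
      subst h4 h5
      exact hker f f' h hf₀ hf₁
  rw [LinearPMap.IsClosed, heq]
  refine IsClosed.inter (LinearPMap.adjoint_isClosed hA) (isClosed_iInter fun y => ?_)
  exact isClosed_eq (by fun_prop) continuous_const

namespace IsTripletWithBound

variable {A : E →ₗ.[ℂ] E} {Γ₀ Γ₁ : E →ₗ.[ℂ] H} {C : ℝ}

/-- Cauchy–Schwarz bounds `‖h‖⁴` by the product of the two squared graph norms; the one belonging to
`g` is at most `C ‖h‖²`, and a factor `‖h‖²` cancels. -/
theorem norm_sq_le_of_inner {E H : Type*} [NormedAddCommGroup E] [InnerProductSpace ℂ E]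
    [NormedAddCommGroup H] {C : ℝ} {f f' g g' : E} {h : H} (hC : 0 ≤ C)
    (hg : ‖g‖ ^ 2 + ‖g'‖ ^ 2 ≤ C * ‖h‖ ^ 2) (hi : ‖h‖ ^ 2 ≤ ‖inner ℂ g f' - inner ℂ g' f‖) :
    ‖h‖ ^ 2 ≤ C * (‖f‖ ^ 2 + ‖f'‖ ^ 2) := by
  have h1 : ‖h‖ ^ 2 ≤ ‖g‖ * ‖f'‖ + ‖g'‖ * ‖f‖ :=
    hi.trans ((norm_sub_le _ _).trans (add_le_add (norm_inner_le_norm _ _)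
      (norm_inner_le_norm _ _)))
  have h2 : (‖h‖ ^ 2) ^ 2 ≤ (‖g‖ ^ 2 + ‖g'‖ ^ 2) * (‖f‖ ^ 2 + ‖f'‖ ^ 2) := by
    refine (pow_le_pow_left₀ (by positivity) h1 2).trans ?_
    nlinarith [sq_nonneg (‖g‖ * ‖f‖ - ‖g'‖ * ‖f'‖)]
  have h3 : (‖h‖ ^ 2) ^ 2 ≤ (C * ‖h‖ ^ 2) * (‖f‖ ^ 2 + ‖f'‖ ^ 2) :=
    h2.trans (mul_le_mul_of_nonneg_right hg (by positivity))
  rcases (sq_nonneg ‖h‖).eq_or_lt with h0 | h0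
  · rw [← h0]; positivity
  · refine le_of_mul_le_mul_left ?_ h0
    nlinarith

/-- The test element with data `(0, -f₀)` reduces the right side of Green's identity to `‖f₀‖²`. For
`bounded₁` the data `(f₁, 0)` do the same. -/
theorem bounded₀ (hT : IsTripletWithBound A Γ₀ Γ₁ C) (hC : 0 ≤ C) {f f' : E} {f₀ : H}
    (hf : (f, f') ∈ A.adjoint.graph) (hf₀ : (f, f₀) ∈ Γ₀.graph) :
    ‖f₀‖ ^ 2 ≤ C * (‖f‖ ^ 2 + ‖f'‖ ^ 2) := by
  obtain ⟨f₁, hf₁⟩ := LinearPMap.mem_domain_iff.1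
    (hT.dom₁.ge (LinearPMap.mem_domain_of_mem_graph hf))
  obtain ⟨g, g', hg, hg₀, hg₁, hb⟩ := hT.surjective 0 (-f₀)
  refine norm_sq_le_of_inner (g := g) (g' := g') hC (by simpa using hb) ?_
  rw [hT.green hf hg hf₀ hf₁ hg₀ hg₁, inner_zero_left, inner_neg_left, sub_neg_eq_add, zero_add,
    inner_self_eq_norm_sq_to_K]
  simp

theorem bounded₁ (hT : IsTripletWithBound A Γ₀ Γ₁ C) (hC : 0 ≤ C) {f f' : E} {f₁ : H}
    (hf : (f, f') ∈ A.adjoint.graph) (hf₁ : (f, f₁) ∈ Γ₁.graph) :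
    ‖f₁‖ ^ 2 ≤ C * (‖f‖ ^ 2 + ‖f'‖ ^ 2) := by
  obtain ⟨f₀, hf₀⟩ := LinearPMap.mem_domain_iff.1
    (hT.dom₀.ge (LinearPMap.mem_domain_of_mem_graph hf))
  obtain ⟨g, g', hg, hg₀, hg₁, hb⟩ := hT.surjective f₁ 0
  refine norm_sq_le_of_inner (g := g) (g' := g') hC (by simpa using hb) ?_
  rw [hT.green hf hg hf₀ hf₁ hg₀ hg₁, inner_zero_left, sub_zero, inner_self_eq_norm_sq_to_K]
  simp

theorem isBoundaryTriplet [CompleteSpace H] (hT : IsTripletWithBound A Γ₀ Γ₁ C) (hC : 0 ≤ C) :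
    IsBoundaryTriplet A Γ₀ Γ₁ where
  dense_domain := hT.dense_domain
  isClosed := hT.isClosed
  symmetric := hT.symmetric
  complete := inferInstance
  dom₀ := hT.dom₀
  dom₁ := hT.dom₁
  bounded₀ := ⟨C, fun f => hT.bounded₀ hC (A.adjoint.mem_graph f)
    (Γ₀.mem_graph ⟨f, hT.dom₀.ge f.2⟩)⟩
  bounded₁ := ⟨C, fun f => hT.bounded₁ hC (A.adjoint.mem_graph f)
    (Γ₁.mem_graph ⟨f, hT.dom₁.ge f.2⟩)⟩
  green := fun f g => hT.green (A.adjoint.mem_graph f) (A.adjoint.mem_graph g)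
    (Γ₀.mem_graph ⟨f, hT.dom₀.ge f.2⟩) (Γ₁.mem_graph ⟨f, hT.dom₁.ge f.2⟩)
    (Γ₀.mem_graph ⟨g, hT.dom₀.ge g.2⟩) (Γ₁.mem_graph ⟨g, hT.dom₁.ge g.2⟩)
  surjective := fun h₀ h₁ => by
    obtain ⟨f, f', hf, hf₀, hf₁, -⟩ := hT.surjective h₀ h₁
    have hd := LinearPMap.mem_domain_of_mem_graph hf
    exact ⟨⟨f, hd⟩, ((LinearPMap.image_iff (hT.dom₀.ge hd)).2 hf₀).symm,
      ((LinearPMap.image_iff (hT.dom₁.ge hd)).2 hf₁).symm⟩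

end IsTripletWithBound

end Uniform

/-! ### Graphs of direct sums, compositions and restrictions -/

section Graphs

variable {G G' : ℕ → Type*}
variable [∀ n, NormedAddCommGroup (G n)] [∀ n, InnerProductSpace ℂ (G n)]
variable [∀ n, NormedAddCommGroup (G' n)] [∀ n, InnerProductSpace ℂ (G' n)]

theorem mem_graph_directSum {S : ∀ n, G n →ₗ.[ℂ] G' n} {f : lp G 2} {g : lp G' 2} :
    (f, g) ∈ (directSum S).graph ↔ ∀ n, (f n, g n) ∈ (S n).graph := by
  constructor
  · intro h n
    obtain ⟨y, hy, hg⟩ := (LinearPMap.mem_graph_iff _).1 h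
    dsimp only at hy hg
    subst hy hg
    exact (S n).mem_graph ⟨(y : lp G 2) n, y.2.choose n⟩
  · intro h
    have hd : ∀ n, f n ∈ (S n).domain := fun n => LinearPMap.mem_domain_of_mem_graph (h n)
    have hv : ∀ n, S n ⟨f n, hd n⟩ = g n := fun n => ((LinearPMap.image_iff (hd n)).2 (h n)).symm
    have hmem : f ∈ (directSum S).domain := by
      refine ⟨hd, ?_⟩
      simp only [hv]
      exact lp.memℓp g
    refine (LinearPMap.mem_graph_iff _).2 ⟨⟨f, hmem⟩, rfl, ?_⟩
    ext n : 2
    exact hv n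

variable {E F K : Type*} [NormedAddCommGroup E] [InnerProductSpace ℂ E]
    [NormedAddCommGroup F] [InnerProductSpace ℂ F] [NormedAddCommGroup K] [InnerProductSpace ℂ K]

theorem mem_graph_pullback {T : F →ₗ.[ℂ] K} {U : E →ₗ[ℂ] F} {f : E} {g : K} :
    (f, g) ∈ (pullback T U).graph ↔ (U f, g) ∈ T.graph := by
  constructor
  · intro h
    obtain ⟨y, hy, hg⟩ := (LinearPMap.mem_graph_iff _).1 h
    dsimp only at hy hg
    subst hy hg
    exact T.mem_graph ⟨U y, y.2⟩
  · intro h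
    have hd : U f ∈ T.domain := LinearPMap.mem_domain_of_mem_graph h
    refine (LinearPMap.mem_graph_iff _).2 ⟨⟨f, hd⟩, rfl, ?_⟩
    exact ((LinearPMap.image_iff hd).2 h).symm

theorem mem_graph_compPMap {T : E →ₗ.[ℂ] F} {U : F ≃ₗ[ℂ] K} {f : E} {g : K} :
    (f, g) ∈ (U.toLinearMap.compPMap T).graph ↔ (f, U.symm g) ∈ T.graph := by
  constructor
  · intro h
    obtain ⟨y, hy, hg⟩ := (LinearPMap.mem_graph_iff _).1 h
    dsimp only at hy hg
    subst hy hg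
    have := T.mem_graph y
    simpa using this
  · intro h
    obtain ⟨y, hy, hg⟩ := (LinearPMap.mem_graph_iff _).1 h
    dsimp only at hy hg
    subst hy
    refine (LinearPMap.mem_graph_iff _).2 ⟨y, rfl, ?_⟩
    exact (congrArg U hg).trans (U.apply_symm_apply g)

theorem mem_graph_domRestrict {T : E →ₗ.[ℂ] F} {D : Submodule ℂ E} {f : E} {g : F} :
    (f, g) ∈ (T.domRestrict D).graph ↔ f ∈ D ∧ (f, g) ∈ T.graph := by
  constructor
  · intro h
    exact ⟨(LinearPMap.mem_domain_of_mem_graph h).1,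
      LinearPMap.le_graph_of_le LinearPMap.domRestrict_le h⟩
  · rintro ⟨hD, h⟩
    have hd := LinearPMap.mem_domain_of_mem_graph h
    refine (LinearPMap.mem_graph_iff _).2 ⟨⟨f, ⟨hD, hd⟩⟩, rfl, ?_⟩
    exact (LinearPMap.domRestrict_apply (x := ⟨f, ⟨hD, hd⟩⟩) (y := ⟨f, hd⟩) rfl).trans
      ((LinearPMap.image_iff hd).2 h).symm

end Graphs

/-! ### Direct sums of operators and of boundary triplets -/

section DirectSumTriplet

variable {G : ℕ → Type*} [∀ n, NormedAddCommGroup (G n)] [∀ n, InnerProductSpace ℂ (G n)]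
variable {E : Type*} [NormedAddCommGroup E] [InnerProductSpace ℂ E]
variable {H : Type*} [NormedAddCommGroup H] [InnerProductSpace ℂ H]

variable {S : ∀ n, G n →ₗ.[ℂ] G n} {A : E →ₗ.[ℂ] E} {U : E ≃ₗᵢ[ℂ] lp G 2}

/-- An element of one summand, as an element of the graph of the direct sum. -/
theorem mem_graph_single
    (hA : ∀ f g, (f, g) ∈ A.graph ↔ ∀ n, (U f n, U g n) ∈ (S n).graph) {n : ℕ} {p q : G n}
    (h : (p, q) ∈ (S n).graph) :
    (U.symm (lp.single 2 n p), U.symm (lp.single 2 n q)) ∈ A.graph := by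
  rw [hA]
  intro m
  rw [U.apply_symm_apply, U.apply_symm_apply]
  by_cases hm : m = n
  · subst hm
    rwa [lp.single_apply_self, lp.single_apply_self]
  · rw [lp.single_apply_ne _ _ _ hm, lp.single_apply_ne _ _ _ hm]
    exact Submodule.zero_mem _

theorem inner_symm_single (n : ℕ) (p : G n) (f : E) :
    inner ℂ (U.symm (lp.single 2 n p)) f = inner ℂ p (U f n) := by
  rw [← U.inner_map_map, U.apply_symm_apply, lp.inner_single_left]

variable [CompleteSpace E]

theorem dense_domain_of_directSum
    (hA : ∀ f g, (f, g) ∈ A.graph ↔ ∀ n, (U f n, U g n) ∈ (S n).graph)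
    (hS : ∀ n, Dense ((S n).domain : Set (G n))) : Dense (A.domain : Set E) := by
  rw [Submodule.dense_iff_topologicalClosure_eq_top, Submodule.topologicalClosure_eq_top_iff,
    Submodule.eq_bot_iff]
  intro f hf
  rw [← U.map_eq_zero_iff]
  ext n : 2
  refine (hS n).eq_zero_of_inner_right ℂ fun p hp => ?_
  rw [← inner_symm_single]
  exact hf _ (LinearPMap.mem_domain_of_mem_graph
    (mem_graph_single hA ((S n).mem_graph ⟨p, hp⟩)))

variable [∀ n, CompleteSpace (G n)]

/-- Testing against elements supported in one summand gives the condition in each component;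
conversely the componentwise identities add up. -/
theorem mem_graph_adjoint_of_directSum
    (hA : ∀ f g, (f, g) ∈ A.graph ↔ ∀ n, (U f n, U g n) ∈ (S n).graph)
    (hS : ∀ n, Dense ((S n).domain : Set (G n))) (f g : E) :
    (f, g) ∈ A.adjoint.graph ↔ ∀ n, (U f n, U g n) ∈ (S n).adjoint.graph := by
  rw [mem_graph_adjoint (dense_domain_of_directSum hA hS)]
  constructor
  · intro h n
    rw [mem_graph_adjoint (hS n)]
    intro p q hpq
    have := h _ _ (mem_graph_single hA hpq)
    rwa [inner_symm_single, inner_symm_single] at this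
  · intro h p q hpq
    rw [← U.inner_map_map, ← U.inner_map_map p, lp.inner_eq_tsum, lp.inner_eq_tsum]
    exact tsum_congr fun n => (mem_graph_adjoint (hS n)).1 (h n) _ _ ((hA p q).1 hpq n)

theorem norm_sq_lp {G : ℕ → Type*} [∀ n, NormedAddCommGroup (G n)] (f : lp G 2) :
    HasSum (fun n => ‖f n‖ ^ 2) (‖f‖ ^ 2) := by
  simpa using lp.hasSum_norm (p := 2) (by norm_num) f

theorem inner_sub_inner_lp {G G' : ℕ → Type*} [∀ n, NormedAddCommGroup (G n)]
    [∀ n, InnerProductSpace ℂ (G n)] [∀ n, NormedAddCommGroup (G' n)]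
    [∀ n, InnerProductSpace ℂ (G' n)] {f f' g g' : lp G 2} {p p' q q' : lp G' 2}
    (h : ∀ n, inner ℂ (g n) (f' n) - inner ℂ (g' n) (f n) =
      inner ℂ (q n) (p' n) - inner ℂ (q' n) (p n)) :
    inner ℂ g f' - inner ℂ g' f = inner ℂ q p' - inner ℂ q' p := by
  have h1 := (lp.hasSum_inner (𝕜 := ℂ) g f').sub (lp.hasSum_inner (𝕜 := ℂ) g' f)
  have h2 := (lp.hasSum_inner (𝕜 := ℂ) q p').sub (lp.hasSum_inner (𝕜 := ℂ) q' p)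
  simp only [h] at h1
  exact h1.unique h2

/-- The constant is common to all summands and is inherited by the sum, which makes the construction
work again at the level of the direct sum. -/
theorem IsTripletWithBound.directSum {Γ₀ Γ₁ : ∀ n, G n →ₗ.[ℂ] H} {C : ℝ} (hC : 0 ≤ C)
    (hA : ∀ f g, (f, g) ∈ A.graph ↔ ∀ n, (U f n, U g n) ∈ (S n).graph)
    (hT : ∀ n, IsTripletWithBound (S n) (Γ₀ n) (Γ₁ n) C) :
    IsTripletWithBound A
      ((pullback (BoundaryTriplets.directSum Γ₀) U.toLinearEquiv.toLinearMap).domRestrict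
        A.adjoint.domain)
      ((pullback (BoundaryTriplets.directSum Γ₁) U.toLinearEquiv.toLinearMap).domRestrict
        A.adjoint.domain) C := by
  have hS := fun n => (hT n).dense_domain
  have hadj := mem_graph_adjoint_of_directSum hA hS
  have hΓ : ∀ {Γ : ∀ n, G n →ₗ.[ℂ] H} {f : E} {h : lp (fun _ : ℕ => H) 2},
      (f, h) ∈ ((pullback (BoundaryTriplets.directSum Γ)
        U.toLinearEquiv.toLinearMap).domRestrict A.adjoint.domain).graph ↔
      f ∈ A.adjoint.domain ∧ ∀ n, (U f n, h n) ∈ (Γ n).graph := by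
    intro Γ f h
    rw [mem_graph_domRestrict, mem_graph_pullback, mem_graph_directSum]
    rfl
  -- The uniform bound dominates `∑ ‖Γₙ fₙ‖²` by the squared graph norm, so the summability
  -- condition in the domain is automatic.
  have hdom : ∀ {Γ : ∀ n, G n →ₗ.[ℂ] H}, (∀ n, (Γ n).domain = (S n).adjoint.domain) →
      (∀ n f f' h, (f, f') ∈ (S n).adjoint.graph → (f, h) ∈ (Γ n).graph →
        ‖h‖ ^ 2 ≤ C * (‖f‖ ^ 2 + ‖f'‖ ^ 2)) →
      ((pullback (BoundaryTriplets.directSum Γ) U.toLinearEquiv.toLinearMap).domRestrict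
        A.adjoint.domain).domain = A.adjoint.domain := by
    intro Γ hd hb
    refine le_antisymm (fun f hf => hf.1) fun f hf => ?_
    obtain ⟨f', hf'⟩ := LinearPMap.mem_domain_iff.1 hf
    have hf'' := (hadj f f').1 hf'
    choose h hh using fun n => LinearPMap.mem_domain_iff.1
      ((hd n).ge (LinearPMap.mem_domain_of_mem_graph (hf'' n)))
    have hm : Memℓp h 2 := by
      refine memℓp_gen ?_
      have hs := ((norm_sq_lp (U f)).summable.add (norm_sq_lp (U f')).summable).mul_left C
      simpa using Summable.of_nonneg_of_le (fun n => by positivity)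
        (fun n => hb n _ _ _ (hf'' n) (hh n)) hs
    exact LinearPMap.mem_domain_of_mem_graph (y := (⟨h, hm⟩ : lp (fun _ : ℕ => H) 2))
      (hΓ.2 ⟨hf, hh⟩)
  refine ⟨dense_domain_of_directSum hA hS, ?_, ?_, hdom (fun n => (hT n).dom₀)
    (fun n _ _ _ h1 h2 => (hT n).bounded₀ hC h1 h2), hdom (fun n => (hT n).dom₁)
    (fun n _ _ _ h1 h2 => (hT n).bounded₁ hC h1 h2), ?_, ?_⟩
  · have heq : (A.graph : Set (E × E)) =
        ⋂ n, (fun x : E × E => (U x.1 n, U x.2 n)) ⁻¹' ((S n).graph : Set (G n × G n)) := by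
      ext ⟨f, g⟩
      simp [hA]
    rw [LinearPMap.IsClosed, heq]
    refine isClosed_iInter fun n => (hT n).isClosed.preimage ?_
    have h1 : Continuous fun f : lp G 2 => f n :=
      (lp.evalCLM ℂ G 2 n).continuous
    exact (h1.comp (U.continuous.comp continuous_fst)).prodMk
      (h1.comp (U.continuous.comp continuous_snd))
  · refine LinearPMap.le_of_le_graph ?_
    rintro ⟨f, g⟩ hfg
    rw [hadj]
    exact fun n => LinearPMap.le_graph_of_le (hT n).symmetric ((hA f g).1 hfg n)
  · intro f f' g g' f₀ f₁ g₀ g₁ hf hg hf₀ hf₁ hg₀ hg₁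
    rw [← U.inner_map_map g, ← U.inner_map_map g']
    refine inner_sub_inner_lp fun n => ?_
    exact (hT n).green ((hadj _ _).1 hf n) ((hadj _ _).1 hg n) ((hΓ.1 hf₀).2 n) ((hΓ.1 hf₁).2 n)
      ((hΓ.1 hg₀).2 n) ((hΓ.1 hg₁).2 n)
  · intro h₀ h₁
    -- Preimages are chosen in each summand; the common bound makes both `f` and `f'` square
    -- summable.
    choose f f' hf hf₀ hf₁ hb using fun n => (hT n).surjective (h₀ n) (h₁ n)
    have hs := ((norm_sq_lp h₀).add (norm_sq_lp h₁)).mul_left C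
    have hsf : Summable fun n => ‖f n‖ ^ 2 := Summable.of_nonneg_of_le (fun n => by positivity)
      (fun n => le_trans (by nlinarith [sq_nonneg ‖f' n‖]) (hb n)) hs.summable
    have hsf' : Summable fun n => ‖f' n‖ ^ 2 := Summable.of_nonneg_of_le (fun n => by positivity)
      (fun n => le_trans (by nlinarith [sq_nonneg ‖f n‖]) (hb n)) hs.summable
    let F : lp G 2 := ⟨f, memℓp_gen (by simpa using hsf)⟩
    let F' : lp G 2 := ⟨f', memℓp_gen (by simpa using hsf')⟩
    have hFA : (U.symm F, U.symm F') ∈ A.adjoint.graph := by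
      rw [hadj]
      intro n
      rw [U.apply_symm_apply, U.apply_symm_apply]
      exact hf n
    have hd := LinearPMap.mem_domain_of_mem_graph hFA
    refine ⟨U.symm F, U.symm F', hFA, hΓ.2 ⟨hd, fun n => ?_⟩, hΓ.2 ⟨hd, fun n => ?_⟩, ?_⟩
    · rw [U.apply_symm_apply]; exact hf₀ n
    · rw [U.apply_symm_apply]; exact hf₁ n
    · rw [U.symm.norm_map, U.symm.norm_map]
      exact hasSum_le hb ((norm_sq_lp F).add (norm_sq_lp F')) hs

end DirectSumTriplet

/-! ### Gluing the cells: `H_min` as a direct sum -/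

namespace IsPartition

variable {b : EReal} {x : ℕ → ℝ}

theorem mem_halfOpen (hx : IsPartition b x) (n : ℕ) : x n ∈ halfOpen b :=
  hx.cell_subset n (left_mem_Icc.2 (hx.step n).le)

theorem isRep_restrictCell (hx : IsPartition b x) {f w : L2 (halfOpen b)} {u v : ℝ → ℂ}
    (h : IsRep (halfOpen b) f u v w) (n : ℕ) :
    IsRep (cell x n) (hx.restrictCell n f) u v (hx.restrictCell n w) where
  ae_eq := (hx.restrictCell_ae n f).trans
    (ae_restrict_of_ae_restrict_of_subset (hx.cell_subset n) h.ae_eq)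
  ac := fun s hs t ht => h.ac s (hx.cell_subset n hs) t (hx.cell_subset n ht)
  hasDeriv := fun t ht => (h.hasDeriv t (hx.cell_subset n ht)).mono (hx.cell_subset n)
  ac_deriv := fun s hs t ht => h.ac_deriv s (hx.cell_subset n hs) t (hx.cell_subset n ht)
  hasDeriv_deriv := by
    filter_upwards [hx.restrictCell_ae n w,
      ae_restrict_of_ae_restrict_of_subset (hx.cell_subset n) h.hasDeriv_deriv] with t h1 h2
    rw [h1]
    exact h2.mono (hx.cell_subset n)

/-- A primitive on `[0, b)` that agrees on each cell, up to constants, with functions vanishing at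
all partition points, agrees with them. -/
theorem integral_eq_of_cells (hx : IsPartition b x) {g : ℝ → ℂ} {G : ℕ → ℝ → ℂ}
    (hi : ∀ s ∈ halfOpen b, ∀ t ∈ halfOpen b, IntervalIntegrable g volume s t)
    (hG : ∀ n, ∀ t ∈ cell x n, ∫ r in x n..t, g r = G n t - G n (x n))
    (h0 : ∀ n, G n (x n) = 0) (h1 : ∀ n, G n (x (n + 1)) = 0) (n : ℕ) {t : ℝ}
    (ht : t ∈ cell x n) : ∫ r in x 0..t, g r = G n t := by
  have key : ∀ n, ∫ r in x 0..x n, g r = 0 := by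
    intro n
    induction n with
    | zero => simp
    | succ n ih =>
      rw [← intervalIntegral.integral_add_adjacent_intervals
        (hi _ (hx.mem_halfOpen 0) _ (hx.mem_halfOpen n))
        (hi _ (hx.mem_halfOpen n) _ (hx.mem_halfOpen (n + 1))), ih,
        hG n _ (right_mem_Icc.2 (hx.step n).le), h0, h1]
      simp
  rw [← intervalIntegral.integral_add_adjacent_intervals
    (hi _ (hx.mem_halfOpen 0) _ (hx.mem_halfOpen n))
    (hi _ (hx.mem_halfOpen n) _ (hx.cell_subset n ht)), key, hG n t ht, h0]
  simp

theorem ae_eq_of_cells (hx : IsPartition b x) {F G : ℝ → ℂ}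
    (h : ∀ n, F =ᵐ[volume.restrict (cell x n)] G) : F =ᵐ[volume.restrict (halfOpen b)] G := by
  rw [EventuallyEq, hx.restrict_eq_sum, Measure.ae_sum_iff]
  exact h

/-- The representative is not pieced together but defined as the double primitive of `w` from `x 0`.
Since the data vanish at every partition point, each cell contributes zero to the primitives, which
therefore coincide with `u n` and `v n` on each cell. Regularity across the partition points is then
immediate. -/
theorem exists_isRep_of_cells (hx : IsPartition b x) {f w : L2 (halfOpen b)} {u v : ℕ → ℝ → ℂ}
    (h : ∀ n, IsRep (cell x n) (hx.restrictCell n f) (u n) (v n) (hx.restrictCell n w))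
    (hu0 : ∀ n, u n (x n) = 0) (hu1 : ∀ n, u n (x (n + 1)) = 0)
    (hv0 : ∀ n, v n (x n) = 0) (hv1 : ∀ n, v n (x (n + 1)) = 0) :
    ∃ p q, IsRep (halfOpen b) f p q w ∧ ∀ t ∈ range x, p t = 0 ∧ q t = 0 := by
  have hJ := hx.isInterval
  have hwi : ∀ s ∈ halfOpen b, ∀ t ∈ halfOpen b, IntervalIntegrable w volume s t :=
    fun s hs t ht => L2.intervalIntegrable hJ w hs ht
  have hl : ∀ n, x n ∈ cell x n := fun n => left_mem_Icc.2 (hx.step n).le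
  set q : ℝ → ℂ := fun t => ∫ r in x 0..t, w r with hq
  have hqv : ∀ n, ∀ t ∈ cell x n, q t = v n t := by
    intro n t ht
    refine hx.integral_eq_of_cells hwi (fun n t ht => ?_) hv0 hv1 n ht
    rw [← (h n).integral_deriv_deriv (isInterval_Icc (hx.step n)) (hl n) ht]
    refine intervalIntegral.integral_congr_ae ?_
    filter_upwards [(ae_restrict_iff' measurableSet_Icc).1 (hx.restrictCell_ae n w)] with r hr hrm
    exact (hr ((isInterval_Icc (hx.step n)).uIcc_subset (hl n) ht (uIoc_subset_uIcc hrm))).symm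
  have hqi : ∀ s ∈ halfOpen b, ∀ t ∈ halfOpen b, IntervalIntegrable q volume s t := by
    have h1 : ∀ t ∈ halfOpen b, IntervalIntegrable q volume (x 0) t := fun t ht =>
      (AbsolutelyContinuousOnInterval.integral_complex (hwi _ (hx.mem_halfOpen 0) t ht)
        left_mem_uIcc).continuousOn.intervalIntegrable
    exact fun s hs t ht => (h1 s hs).symm.trans (h1 t ht)
  set p : ℝ → ℂ := fun t => ∫ r in x 0..t, q r with hp
  have hpu : ∀ n, ∀ t ∈ cell x n, p t = u n t := by
    intro n t ht
    refine hx.integral_eq_of_cells hqi (fun n t ht => ?_) hu0 hu1 n ht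
    rw [← (h n).integral_deriv (isInterval_Icc (hx.step n)) (hl n) ht]
    exact intervalIntegral.integral_congr fun r hr =>
      hqv n r ((isInterval_Icc (hx.step n)).uIcc_subset (hl n) ht hr)
  refine ⟨p, q, IsRep.of_integral hJ (hx.mem_halfOpen 0) ?_ ?_ ?_, ?_⟩
  · refine hx.ae_eq_of_cells fun n => ?_
    filter_upwards [(h n).ae_eq, hx.restrictCell_ae n f, ae_restrict_mem measurableSet_Icc]
      with t h1 h2 ht
    rw [← h2, h1, hpu n t ht]
  · intro t _; simp [hp]
  · intro t _; simp [hq]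
  · rintro _ ⟨n, rfl⟩
    exact ⟨(hpu n _ (hl n)).trans (hu0 n), (hqv n _ (hl n)).trans (hv0 n)⟩

/-- `H_min` is the direct sum of the cell operators, in terms of graphs. -/
theorem mem_graph_Hmin (hx : IsPartition b x) (f g : L2 (halfOpen b)) :
    (f, g) ∈ hx.Hmin.graph ↔
      ∀ n, (hx.decomp f n, hx.decomp g n) ∈ (hx.cellOperator n).graph := by
  change _ ↔ ∀ n, (hx.restrictCell n f, hx.restrictCell n g) ∈ (hx.cellOperator n).graph
  constructor
  · intro h n
    obtain ⟨u, v, hr, h0⟩ := (mem_graph_minimalOperator _).1 h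
    refine (mem_graph_minimalOperator _).2 ⟨u, v, ?_, ?_⟩
    · rw [← map_neg]
      exact hx.isRep_restrictCell hr n
    · rintro t (rfl | rfl) <;> exact h0 _ (mem_range_self _)
  · intro h
    choose u v hr h0 using fun n => (mem_graph_minimalOperator _).1 (h n)
    refine (mem_graph_minimalOperator _).2 (hx.exists_isRep_of_cells (u := u) (v := v) ?_
      (fun n => (h0 n _ (by simp)).1) (fun n => (h0 n _ (by simp)).1)
      (fun n => (h0 n _ (by simp)).2) (fun n => (h0 n _ (by simp)).2))
    intro n
    rw [map_neg]
    exact hr n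

end IsPartition

/-! ### Cubic polynomials with prescribed boundary data -/

/-- In terms of `r = √d` all fractional powers become integer powers, and the identities for the
boundary maps become rational. -/
theorem rpow_half_pos_sq_cube {d : ℝ} (hd : 0 < d) : 0 < d ^ (1 / 2 : ℝ) ∧
    d = (d ^ (1 / 2 : ℝ)) ^ 2 ∧ d ^ (3 / 2 : ℝ) = (d ^ (1 / 2 : ℝ)) ^ 3 := by
  refine ⟨Real.rpow_pos_of_pos hd _, ?_, ?_⟩ <;>
    rw [← Real.rpow_natCast, ← Real.rpow_mul hd.le] <;> norm_num

theorem norm_le_of_ae_bound_Icc {a b : ℝ} (hab : a < b) {f : L2 (Icc a b)} {u : ℝ → ℂ}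
    (hf : f =ᵐ[volume.restrict (Icc a b)] u) {M : ℝ} (hM : 0 ≤ M)
    (hu : ∀ t ∈ Icc a b, ‖u t‖ ≤ M) : ‖f‖ ≤ (b - a) ^ (1 / 2 : ℝ) * M := by
  have h := Lp.norm_le_of_ae_bound (f := f) hM (by
    filter_upwards [hf, ae_restrict_mem measurableSet_Icc] with t h1 h2
    rw [h1]; exact hu t h2)
  refine h.trans (le_of_eq ?_)
  have h1 : (measureUnivNNReal (volume.restrict (Icc a b)) : ℝ) = b - a := by
    simp only [measureUnivNNReal, Measure.restrict_apply_univ, Real.volume_Icc]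
    exact ENNReal.toReal_ofReal (sub_pos.2 hab).le
  rw [h1]
  norm_num

/-- Cubic polynomials in `W^{2,2}[a, b]`, in the scaling adapted to the boundary maps. -/
theorem exists_cubic {a b : ℝ} (hab : a < b) (A B c₁ c₂ c₃ : ℂ) :
    ∃ (f : L2 (Icc a b)) (u v : ℝ → ℂ) (w : L2 (Icc a b)), IsRep (Icc a b) f u v w ∧
      u a = A / ((b - a) ^ (1 / 2 : ℝ) : ℝ) ∧
      u b = (A + B) / ((b - a) ^ (1 / 2 : ℝ) : ℝ) +
        ((b - a) ^ (3 / 2 : ℝ) : ℝ) * (c₁ + c₂ + c₃) ∧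
      v a = B / ((b - a) ^ (3 / 2 : ℝ) : ℝ) + ((b - a) ^ (1 / 2 : ℝ) : ℝ) * c₁ ∧
      v b = B / ((b - a) ^ (3 / 2 : ℝ) : ℝ) +
        ((b - a) ^ (1 / 2 : ℝ) : ℝ) * (c₁ + 2 * c₂ + 3 * c₃) ∧
      ‖f‖ ≤ ‖A‖ + ‖B‖ + (b - a) ^ 2 * (‖c₁‖ + ‖c₂‖ + ‖c₃‖) ∧
      ‖w‖ ≤ 2 * ‖c₂‖ + 6 * ‖c₃‖ := by
  have hd : 0 < b - a := sub_pos.2 hab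
  obtain ⟨hr0, hr2, hr3⟩ := rpow_half_pos_sq_cube hd
  set r : ℝ := (b - a) ^ (1 / 2 : ℝ) with hr
  rw [hr3]
  have hrc : (r : ℂ) ≠ 0 := by exact_mod_cast hr0.ne'
  have hs : ∀ t : ℝ, HasDerivAt (fun t : ℝ => (((t - a) / r ^ 2 : ℝ) : ℂ)) (1 / r ^ 2 : ℂ) t := by
    intro t
    have := (((hasDerivAt_id t).sub_const a).div_const (r ^ 2)).ofReal_comp
    simpa using this
  set s : ℝ → ℂ := fun t : ℝ => (((t - a) / r ^ 2 : ℝ) : ℂ) with hsdef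
  have hsc : Continuous s := continuous_iff_continuousAt.2 fun t => (hs t).continuousAt
  have hsa : s a = 0 := by simp [hsdef]
  have hsb : s b = 1 := by
    simp only [hsdef]
    rw [hr2, div_self (by positivity)]; simp
  have hsn : ∀ t ∈ Icc a b, ‖s t‖ ≤ 1 := by
    intro t ht
    simp only [hsdef, Complex.norm_real, Real.norm_eq_abs]
    rw [abs_of_nonneg (div_nonneg (sub_nonneg.2 ht.1) (by positivity)),
      div_le_one (by positivity), ← hr2]
    linarith [ht.2]
  -- Here `s` runs from 0 to 1 and `s' = 1 / r²`. Passing from the supremum to the `L²` norm costs a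
  -- factor `r`, so the affine part has norm of order 1, the part with factor `r³` of order `r⁴ =
  -- d²`, and the second derivative, of size `1 / r`, of order 1.
  obtain ⟨f, w, h, hf, hw⟩ := exists_isRep_of_hasDerivAt hab
    (u := fun t => (A + B * s t) / r + r ^ 3 * (c₁ * s t + c₂ * s t ^ 2 + c₃ * s t ^ 3))
    (v := fun t => B / r ^ 3 + r * (c₁ + 2 * c₂ * s t + 3 * c₃ * s t ^ 2))
    (w := fun t => (2 * c₂ + 6 * c₃ * s t) / r)
    (fun t => by
      refine (((((hs t).const_mul B).const_add A).div_const _).add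
        (((((hs t).const_mul c₁).add (((hs t).pow 2).const_mul c₂)).add
          (((hs t).pow 3).const_mul c₃)).const_mul _)).congr_deriv ?_
      field_simp
      push_cast
      ring)
    (fun t => by
      refine ((((((hs t).const_mul (2 * c₂)).const_add c₁).add
          (((hs t).pow 2).const_mul (3 * c₃))).const_mul (r : ℂ)).const_add _).congr_deriv ?_
      field_simp
      push_cast
      ring)
    (by fun_prop)
  refine ⟨f, _, _, w, h, ?_, ?_, ?_, ?_, ?_, ?_⟩
  · simp [hsa]
  · simp [hsb]
  · simp [hsa]
  · simp [hsb]
  · have h1 := norm_le_of_ae_bound_Icc hab hf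
      (M := (‖A‖ + ‖B‖) / r + r ^ 3 * (‖c₁‖ + ‖c₂‖ + ‖c₃‖)) (by positivity) (by
      intro t ht
      have hst := hsn t ht
      have hp : ∀ (c : ℂ) (k : ℕ), ‖c * s t ^ k‖ ≤ ‖c‖ := fun c k => by
        rw [norm_mul, norm_pow]
        exact mul_le_of_le_one_right (norm_nonneg _) (pow_le_one₀ (norm_nonneg _) hst)
      have hp1 : ∀ c : ℂ, ‖c * s t‖ ≤ ‖c‖ := fun c => by simpa using hp c 1
      refine (norm_add_le _ _).trans (add_le_add ?_ ?_)
      · rw [norm_div, Complex.norm_real, Real.norm_of_nonneg hr0.le]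
        gcongr
        exact (norm_add_le _ _).trans (add_le_add le_rfl (hp1 B))
      · rw [norm_mul, norm_pow, Complex.norm_real, Real.norm_of_nonneg hr0.le]
        gcongr
        exact (norm_add₃_le).trans (add_le_add (add_le_add (hp1 _) (hp _ _)) (hp _ _)))
    refine h1.trans (le_of_eq ?_)
    rw [← hr, hr2]
    field_simp
  · have h1 := norm_le_of_ae_bound_Icc hab hw
      (M := (2 * ‖c₂‖ + 6 * ‖c₃‖) / r) (by positivity) (by
      intro t ht
      have hst := hsn t ht
      rw [norm_div, Complex.norm_real, Real.norm_of_nonneg hr0.le]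
      gcongr
      refine (norm_add_le _ _).trans (add_le_add (by simp) ?_)
      rw [norm_mul, norm_mul]
      simpa using mul_le_of_le_one_right (by positivity) hst)
    refine h1.trans (le_of_eq ?_)
    rw [← hr]
    field_simp

/-! ### The two regularized triplets on one cell -/

section Interval

variable {a b : ℝ} (hab : a < b)

theorem rep_eq {a b : ℝ} (hab : a < b) {f w : L2 (Icc a b)} {u v : ℝ → ℂ}
    (h : IsRep (Icc a b) f u v w)
    (hf : f ∈ W22 (Icc a b)) : rep ⟨f, hf⟩ a = u a ∧ rep ⟨f, hf⟩ b = u b ∧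
      repDeriv ⟨f, hf⟩ a = v a ∧ repDeriv ⟨f, hf⟩ b = v b := by
  have ha := left_mem_Icc.2 hab.le
  have hb := right_mem_Icc.2 hab.le
  obtain ⟨h1, h2, -⟩ := (isRep ⟨f, hf⟩).unique (isInterval_Icc hab) h
  exact ⟨h1 ha, h1 hb, h2 ha, h2 hb⟩

/-- A criterion for boundary triplets on `[a, b]` whose boundary maps are functions `γ₀`, `γ₁` of
the boundary values `u(a)`, `u(b)`, `u'(a)`, `u'(b)`. -/
theorem isTripletWithBound_intervalOperator {H : Type*} [NormedAddCommGroup H]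
    [InnerProductSpace ℂ H] {Γ₀ Γ₁ : L2 (Icc a b) →ₗ.[ℂ] H} {γ₀ γ₁ : ℂ → ℂ → ℂ → ℂ → H} {C : ℝ}
    (dom₀ : Γ₀.domain = W22 (Icc a b)) (dom₁ : Γ₁.domain = W22 (Icc a b))
    (hΓ₀ : ∀ {f u v w}, IsRep (Icc a b) f u v w → (f, γ₀ (u a) (u b) (v a) (v b)) ∈ Γ₀.graph)
    (hΓ₁ : ∀ {f u v w}, IsRep (Icc a b) f u v w → (f, γ₁ (u a) (u b) (v a) (v b)) ∈ Γ₁.graph)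
    (green : ∀ ua ub va vb pa pb qa qb : ℂ,
      (star pa * va - star qa * ua) - (star pb * vb - star qb * ub) =
        inner ℂ (γ₀ pa pb qa qb) (γ₁ ua ub va vb) - inner ℂ (γ₁ pa pb qa qb) (γ₀ ua ub va vb))
    (ker : ∀ ua ub va vb : ℂ, γ₀ ua ub va vb = 0 → γ₁ ua ub va vb = 0 →
      (ua = 0 ∧ va = 0) ∧ (ub = 0 ∧ vb = 0))
    (surj : ∀ h₀ h₁ : H, ∃ f u v w, IsRep (Icc a b) f u v w ∧ γ₀ (u a) (u b) (v a) (v b) = h₀ ∧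
      γ₁ (u a) (u b) (v a) (v b) = h₁ ∧ ‖f‖ ^ 2 + ‖w‖ ^ 2 ≤ C * (‖h₀‖ ^ 2 + ‖h₁‖ ^ 2)) :
    IsTripletWithBound (intervalOperator hab) Γ₀ Γ₁ C := by
  have hdense := dense_intervalOperator hab
  have hsymm := intervalOperator_le_adjoint hab
  have hadj := adjoint_intervalOperator hab
  have hd₀ : Γ₀.domain = (intervalOperator hab).adjoint.domain := by rw [hadj]; exact dom₀
  have hd₁ : Γ₁.domain = (intervalOperator hab).adjoint.domain := by rw [hadj]; exact dom₁
  have hgreen : ∀ {f f' g g' : L2 (Icc a b)} {f₀ f₁ g₀ g₁ : H},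
      (f, f') ∈ (intervalOperator hab).adjoint.graph →
      (g, g') ∈ (intervalOperator hab).adjoint.graph → (f, f₀) ∈ Γ₀.graph →
      (f, f₁) ∈ Γ₁.graph → (g, g₀) ∈ Γ₀.graph → (g, g₁) ∈ Γ₁.graph →
      inner ℂ g f' - inner ℂ g' f = inner ℂ g₀ f₁ - inner ℂ g₁ f₀ := by
    intro f f' g g' f₀ f₁ g₀ g₁ hf hg hf₀ hf₁ hg₀ hg₁
    rw [hadj] at hf hg
    obtain ⟨u, v, hr⟩ := (mem_graph_negSecondDeriv _).1 hf
    obtain ⟨p, q, hs⟩ := (mem_graph_negSecondDeriv _).1 hg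
    rw [Γ₀.mem_graph_snd_inj hf₀ (hΓ₀ hr) rfl, Γ₁.mem_graph_snd_inj hf₁ (hΓ₁ hr) rfl,
      Γ₀.mem_graph_snd_inj hg₀ (hΓ₀ hs) rfl, Γ₁.mem_graph_snd_inj hg₁ (hΓ₁ hs) rfl, ← green]
    have h := hr.green hab hs
    rw [inner_neg_left, inner_neg_right] at h
    linear_combination -h
  have hsurj : ∀ h₀ h₁ : H, ∃ f f', (f, f') ∈ (intervalOperator hab).adjoint.graph ∧
      (f, h₀) ∈ Γ₀.graph ∧ (f, h₁) ∈ Γ₁.graph ∧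
      ‖f‖ ^ 2 + ‖f'‖ ^ 2 ≤ C * (‖h₀‖ ^ 2 + ‖h₁‖ ^ 2) := by
    intro h₀ h₁
    obtain ⟨f, u, v, w, hr, rfl, rfl, hb⟩ := surj h₀ h₁
    refine ⟨f, -w, ?_, hΓ₀ hr, hΓ₁ hr, by rwa [norm_neg]⟩
    rw [hadj, mem_graph_negSecondDeriv]
    exact ⟨u, v, by rwa [neg_neg]⟩
  refine ⟨hdense, isClosed_of_green hdense hsymm hd₀ hd₁ hgreen (fun h₀ h₁ => ?_) ?_, hsymm, hd₀,
    hd₁, hgreen, hsurj⟩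
  · obtain ⟨f, f', h1, h2, h3, -⟩ := hsurj h₀ h₁
    exact ⟨f, f', h1, h2, h3⟩
  · intro f f' hf hf₀ hf₁
    rw [hadj, mem_graph_negSecondDeriv] at hf
    obtain ⟨u, v, hr⟩ := hf
    have hk := ker _ _ _ _ (Γ₀.mem_graph_snd_inj (hΓ₀ hr) hf₀ rfl)
      (Γ₁.mem_graph_snd_inj (hΓ₁ hr) hf₁ rfl)
    refine (mem_graph_minimalOperator _).2 ⟨u, v, hr, ?_⟩
    rintro t (rfl | rfl)
    · exact hk.1
    · exact hk.2

/-- The bound for the right inverses of the boundary maps on intervals of length at most `D`. -/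
theorem sq_add_sq_le {m k X Y d D : ℝ} (hm : 0 ≤ m) (hk : 0 ≤ k) (hY : 0 ≤ Y)
    (hd : 0 ≤ d) (hdD : d ≤ D) (h1 : m ≤ 3 * X + d ^ 2 * (9 * Y)) (h2 : k ≤ 28 * Y) :
    m ^ 2 + k ^ 2 ≤ (1000 + 162 * D ^ 4) * (X ^ 2 + Y ^ 2) := by
  have h3 : m ≤ 3 * X + D ^ 2 * (9 * Y) := h1.trans (by gcongr)
  have h4 := pow_le_pow_left₀ hm h3 2
  have h5 := pow_le_pow_left₀ hk h2 2
  have h6 : 0 ≤ D ^ 4 * X ^ 2 := by positivity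
  -- From `(p + q)² ≤ 2p² + 2q²` come `18 X²` and `162 D⁴ Y²`; with `28² = 784` the coefficient 1000
  -- leaves room. The hints 3, 9 and 28 are large enough for both triplets.
  nlinarith [sq_nonneg (3 * X - D ^ 2 * (9 * Y)), sq_nonneg X, sq_nonneg Y]

theorem isTripletWithBound_gammaA {D : ℝ} (hD : b - a ≤ D) :
    IsTripletWithBound (intervalOperator hab) (gammaZeroA hab) (gammaOneA hab)
      (1000 + 162 * D ^ 4) := by
  have hd : 0 < b - a := sub_pos.2 hab
  obtain ⟨hr0, hr2, hr3⟩ := rpow_half_pos_sq_cube hd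
  have hrc : (((b - a) ^ (1 / 2 : ℝ) : ℝ) : ℂ) ≠ 0 := by exact_mod_cast hr0.ne'
  have hr2c : ((b - a : ℝ) : ℂ) = (((b - a) ^ (1 / 2 : ℝ) : ℝ) : ℂ) ^ 2 := by exact_mod_cast hr2
  have hr3c : (((b - a) ^ (3 / 2 : ℝ) : ℝ) : ℂ) = (((b - a) ^ (1 / 2 : ℝ) : ℝ) : ℂ) ^ 3 := by
    exact_mod_cast hr3
  refine isTripletWithBound_intervalOperator hab
    (γ₀ := fun ua ub _ _ => !₂[(((b - a) ^ (1 / 2 : ℝ) : ℝ) : ℂ) * ua,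
      -(((b - a) ^ (1 / 2 : ℝ) : ℝ) : ℂ) * ub])
    (γ₁ := fun ua ub va vb =>
      !₂[(((b - a : ℝ) : ℂ) * va + (ua - ub)) / (((b - a) ^ (3 / 2 : ℝ) : ℝ) : ℂ),
        (((b - a : ℝ) : ℂ) * vb + (ua - ub)) / (((b - a) ^ (3 / 2 : ℝ) : ℝ) : ℂ)])
    rfl rfl ?_ ?_ ?_ ?_ ?_
  · intro f u v w h
    have hf : f ∈ W22 (Icc a b) := ⟨u, v, w, h⟩
    obtain ⟨h1, h2, h3, h4⟩ := rep_eq hab h hf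
    rw [← h1, ← h2]
    exact (gammaZeroA hab).mem_graph ⟨f, hf⟩
  · intro f u v w h
    have hf : f ∈ W22 (Icc a b) := ⟨u, v, w, h⟩
    obtain ⟨h1, h2, h3, h4⟩ := rep_eq hab h hf
    rw [← h1, ← h2, ← h3, ← h4]
    exact (gammaOneA hab).mem_graph ⟨f, hf⟩
  · intro ua ub va vb pa pb qa qb
    rw [hr2c, hr3c]
    generalize (b - a) ^ (1 / 2 : ℝ) = r at *
    simp only [PiLp.inner_apply, Fin.sum_univ_two, RCLike.inner_apply, Matrix.cons_val_zero,
      Matrix.cons_val_one, map_mul, map_neg, map_div₀, map_add, map_sub, map_pow,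
      Complex.conj_ofReal, ← starRingEnd_apply]
    field_simp
    ring
  · intro ua ub va vb h0 h1
    rw [hr2c, hr3c] at h1
    generalize (b - a) ^ (1 / 2 : ℝ) = r at *
    have h00 := congrFun (congrArg WithLp.ofLp h0) 0
    have h01 := congrFun (congrArg WithLp.ofLp h0) 1
    have h10 := congrFun (congrArg WithLp.ofLp h1) 0
    have h11 := congrFun (congrArg WithLp.ofLp h1) 1
    simp [hr0.ne'] at h00 h01
    subst h00 h01
    simp [hr0.ne'] at h10 h11
    exact ⟨⟨rfl, h10⟩, rfl, h11⟩
  · intro h₀ h₁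
    -- The affine part takes the prescribed values at both ends. The correction vanishes there, `c₁
    -- + c₂ + c₃ = 0`, and its slopes are fixed by `c₁ = h₁ 0` and `c₁ + 2c₂ + 3c₃ = h₁ 1`.
    obtain ⟨f, u, v, w, hr, hua, hub, hva, hvb, hf, hw⟩ := exists_cubic hab (h₀ 0)
      (-h₀ 1 - h₀ 0) (h₁ 0) (-2 * h₁ 0 - h₁ 1) (h₁ 0 + h₁ 1)
    refine ⟨f, u, v, w, hr, ?_, ?_, ?_⟩
    · rw [hua, hub, hr3c]
      ext i
      fin_cases i <;> simp <;> field_simp <;> ring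
    · rw [hua, hub, hva, hvb, hr2c, hr3c]
      ext i
      fin_cases i <;> simp <;> field_simp <;> ring
    · have n0 := PiLp.norm_apply_le h₀
      have n1 := PiLp.norm_apply_le h₁
      have e1 : ‖-h₀ 1 - h₀ 0‖ ≤ ‖h₀‖ + ‖h₀‖ := (norm_sub_le _ _).trans
        (add_le_add (by rw [norm_neg]; exact n0 1) (n0 0))
      have e2 : ‖-2 * h₁ 0 - h₁ 1‖ ≤ 2 * ‖h₁‖ + ‖h₁‖ := (norm_sub_le _ _).trans
        (add_le_add (by rw [norm_mul]; simpa using n1 0) (n1 1))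
      have e3 : ‖h₁ 0 + h₁ 1‖ ≤ ‖h₁‖ + ‖h₁‖ := (norm_add_le _ _).trans
        (add_le_add (n1 0) (n1 1))
      refine sq_add_sq_le (norm_nonneg _) (norm_nonneg _) (norm_nonneg _) hd.le hD
        (hf.trans (add_le_add (by linarith [n0 0]) (mul_le_mul_of_nonneg_left ?_ (sq_nonneg _))))
        (hw.trans ?_)
      · linarith [n1 0, norm_nonneg h₁]
      · linarith [norm_nonneg h₁]

theorem isTripletWithBound_gammaB {D : ℝ} (hD : b - a ≤ D) :
    IsTripletWithBound (intervalOperator hab) (gammaZeroB hab) (gammaOneB hab)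
      (1000 + 162 * D ^ 4) := by
  have hd : 0 < b - a := sub_pos.2 hab
  obtain ⟨hr0, hr2, hr3⟩ := rpow_half_pos_sq_cube hd
  have hrc : (((b - a) ^ (1 / 2 : ℝ) : ℝ) : ℂ) ≠ 0 := by exact_mod_cast hr0.ne'
  have hr2c : ((b - a : ℝ) : ℂ) = (((b - a) ^ (1 / 2 : ℝ) : ℝ) : ℂ) ^ 2 := by exact_mod_cast hr2
  have hr3c : (((b - a) ^ (3 / 2 : ℝ) : ℝ) : ℂ) = (((b - a) ^ (1 / 2 : ℝ) : ℝ) : ℂ) ^ 3 := by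
    exact_mod_cast hr3
  refine isTripletWithBound_intervalOperator hab
    (γ₀ := fun ua _ _ vb => !₂[(((b - a) ^ (1 / 2 : ℝ) : ℝ) : ℂ) * ua,
      (((b - a) ^ (3 / 2 : ℝ) : ℝ) : ℂ) * vb])
    (γ₁ := fun ua ub va vb =>
      !₂[(va - vb) / (((b - a) ^ (1 / 2 : ℝ) : ℝ) : ℂ),
        (ub - ua - ((b - a : ℝ) : ℂ) * vb) / (((b - a) ^ (3 / 2 : ℝ) : ℝ) : ℂ)])
    rfl rfl ?_ ?_ ?_ ?_ ?_
  · intro f u v w h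
    have hf : f ∈ W22 (Icc a b) := ⟨u, v, w, h⟩
    obtain ⟨h1, h2, h3, h4⟩ := rep_eq hab h hf
    rw [← h1, ← h4]
    exact (gammaZeroB hab).mem_graph ⟨f, hf⟩
  · intro f u v w h
    have hf : f ∈ W22 (Icc a b) := ⟨u, v, w, h⟩
    obtain ⟨h1, h2, h3, h4⟩ := rep_eq hab h hf
    rw [← h1, ← h2, ← h3, ← h4]
    exact (gammaOneB hab).mem_graph ⟨f, hf⟩
  · intro ua ub va vb pa pb qa qb
    rw [hr2c, hr3c]
    generalize (b - a) ^ (1 / 2 : ℝ) = r at *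
    simp only [PiLp.inner_apply, Fin.sum_univ_two, RCLike.inner_apply, Matrix.cons_val_zero,
      Matrix.cons_val_one, map_mul, map_div₀, map_sub, map_pow,
      Complex.conj_ofReal, ← starRingEnd_apply]
    field_simp
    ring
  · intro ua ub va vb h0 h1
    rw [hr3c] at h0
    rw [hr2c, hr3c] at h1
    generalize (b - a) ^ (1 / 2 : ℝ) = r at *
    have h00 := congrFun (congrArg WithLp.ofLp h0) 0
    have h01 := congrFun (congrArg WithLp.ofLp h0) 1
    have h10 := congrFun (congrArg WithLp.ofLp h1) 0
    have h11 := congrFun (congrArg WithLp.ofLp h1) 1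
    simp [hr0.ne'] at h00 h01
    subst h00 h01
    simp [hr0.ne'] at h10 h11
    exact ⟨⟨rfl, h10⟩, h11, rfl⟩
  · intro h₀ h₁
    -- The affine part takes the prescribed value at `a` and slope at `b`. The correction has zero
    -- slope at `b`, `c₁ + 2c₂ + 3c₃ = 0`, together with `c₁ = h₁ 0` and `c₁ + c₂ + c₃ = h₁ 1`.
    obtain ⟨f, u, v, w, hr, hua, hub, hva, hvb, hf, hw⟩ := exists_cubic hab (h₀ 0)
      (h₀ 1) (h₁ 0) (3 * h₁ 1 - 2 * h₁ 0) (h₁ 0 - 2 * h₁ 1)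
    refine ⟨f, u, v, w, hr, ?_, ?_, ?_⟩
    · rw [hua, hvb, hr3c]
      ext i
      fin_cases i <;> simp <;> field_simp <;> ring
    · rw [hua, hub, hva, hvb, hr2c, hr3c]
      ext i
      fin_cases i <;> simp <;> field_simp <;> ring
    · have n0 := PiLp.norm_apply_le h₀
      have n1 := PiLp.norm_apply_le h₁
      have e2 : ‖3 * h₁ 1 - 2 * h₁ 0‖ ≤ 3 * ‖h₁‖ + 2 * ‖h₁‖ := (norm_sub_le _ _).trans
        (add_le_add (by rw [norm_mul]; simpa using n1 1) (by rw [norm_mul]; simpa using n1 0))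
      have e3 : ‖h₁ 0 - 2 * h₁ 1‖ ≤ ‖h₁‖ + 2 * ‖h₁‖ := (norm_sub_le _ _).trans
        (add_le_add (n1 0) (by rw [norm_mul]; simpa using n1 1))
      refine sq_add_sq_le (norm_nonneg _) (norm_nonneg _) (norm_nonneg _) hd.le hD
        (hf.trans (add_le_add (by linarith [n0 0, n0 1, norm_nonneg h₀])
          (mul_le_mul_of_nonneg_left ?_ (sq_nonneg _)))) (hw.trans ?_)
      · linarith [n1 0, norm_nonneg h₁]
      · linarith [norm_nonneg h₁]

end Interval

end BoundaryTriplets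

/-! ### The theorem -/

theorem mainTheorem4 (b : EReal) (x : ℕ → ℝ) (hx : IsPartition b x)
    (hd : BddAbove (Set.range fun n => x (n + 1) - x n)) :
    -- `H_min = ⊕ Hₙ` and `H_min† = ⊕ Hₙ†`, under the identification of `L²[0, b)` with `⊕ L²[xₙ, xₙ₊₁]`
    hx.decomp.toLinearEquiv.toLinearMap.compPMap hx.Hmin =
        pullback (directSum fun n => hx.cellOperator n) hx.decomp.toLinearEquiv.toLinearMap ∧
    hx.decomp.toLinearEquiv.toLinearMap.compPMap hx.Hmin.adjoint =
        pullback (directSum fun n => (hx.cellOperator n).adjoint)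
          hx.decomp.toLinearEquiv.toLinearMap ∧
    -- the first regularized triplets
    (∀ n, IsBoundaryTriplet (hx.cellOperator n) (gammaZeroA (hx.step n)) (gammaOneA (hx.step n))) ∧
    IsBoundaryTriplet hx.Hmin (hx.boundarySum fun n => gammaZeroA (hx.step n))
      (hx.boundarySum fun n => gammaOneA (hx.step n)) ∧
    -- the second regularized triplets
    (∀ n, IsBoundaryTriplet (hx.cellOperator n) (gammaZeroB (hx.step n)) (gammaOneB (hx.step n))) ∧
    IsBoundaryTriplet hx.Hmin (hx.boundarySum fun n => gammaZeroB (hx.step n))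
      (hx.boundarySum fun n => gammaOneB (hx.step n)) := by
  obtain ⟨D, hD⟩ := hd
  have hD' : ∀ n, x (n + 1) - x n ≤ D := fun n => hD ⟨n, rfl⟩
  have hC : 0 ≤ 1000 + 162 * D ^ 4 := by positivity
  have hA := fun n => isTripletWithBound_gammaA (hx.step n) (hD' n)
  have hB := fun n => isTripletWithBound_gammaB (hx.step n) (hD' n)
  have hdirect : ∀ {T : L2 (halfOpen b) →ₗ.[ℂ] L2 (halfOpen b)}
      {S : ∀ n, L2 (IsPartition.cell x n) →ₗ.[ℂ] L2 (IsPartition.cell x n)},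
      (∀ f g, (f, g) ∈ T.graph ↔ ∀ n, (hx.decomp f n, hx.decomp g n) ∈ (S n).graph) →
      hx.decomp.toLinearEquiv.toLinearMap.compPMap T =
        pullback (directSum S) hx.decomp.toLinearEquiv.toLinearMap := by
    intro T S h
    refine LinearPMap.eq_of_eq_graph ?_
    ext ⟨f, g⟩
    rw [mem_graph_compPMap, mem_graph_pullback, mem_graph_directSum, h]
    refine forall_congr' fun n => ?_
    rw [show hx.decomp (hx.decomp.toLinearEquiv.symm g) = g from hx.decomp.apply_symm_apply g]
    rfl
  refine ⟨hdirect hx.mem_graph_Hmin, hdirect (mem_graph_adjoint_of_directSum hx.mem_graph_Hmin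
    fun n => dense_intervalOperator (hx.step n)), fun n => (hA n).isBoundaryTriplet hC, ?_,
    fun n => (hB n).isBoundaryTriplet hC, ?_⟩
  · exact (IsTripletWithBound.directSum hC hx.mem_graph_Hmin hA).isBoundaryTriplet hC
  · exact (IsTripletWithBound.directSum hC hx.mem_graph_Hmin hB).isBoundaryTriplet hC
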